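/- Let $\mathbb{G}=(\mathbb{R}^N,\circ)$ be a stratified Lie group (homogeneous Carnot group) with layers $\mathbb{R}^N=\mathbb{R}^{N_1}\times\cdots\times\mathbb{R}^{N_k}$, dilations $D_t(x)=(tx^{(1)},t^2x^{(2)},\dots,t^kx^{(k)})$, homogeneous dimension $Q=\sum_{i=1}^k iN_i$ and Haar measure $dx$ (the Lebesgue measure), and let $|\cdot|$ be a homogeneous quasi-norm on $\mathbb{G}$, i.e. a continuous function $\mathbb{G}\to[0,\infty)$ with $|x|=0\iff x=0$, $|x^{-1}|=|x|$ and $|D_t x|=t|x|$ for $t>0$. Let $\Omega\subset\mathbb{G}$ be a bounded domain (open, connected, non-empty), let $0<s<1$, $0<\delta<1$, $\lambda>0$, $1<p<\infty$ with $sp<Q$, and let $q\in\mathbb{R}$ satisfy $$p<q+1<p_s^*:=\frac{Qp}{Q-sp}.$$ Let $f,g\in L^\infty(\Omega)$ with $f,g>0$ a.e. in $\Omega$. Let $X_0^{s,p}(\Omega)$ be the closure of $C_c^\infty(\Omega)$ with respect to the norm $\|u\|_{L^p(\Omega)}+[u]_{s,p,\mathbb{G}}$, where $$[u]_{s,p,\mathbb{G}}=\left(\iint_{\mathbb{G}\times\mathbb{G}}\frac{|u(x)-u(y)|^p}{|y^{-1}\circ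 x|^{Q+ps}}\,dx\,dy\right)^{1/p};$$ its elements are regarded as functions on $\mathbb{G}$ vanishing a.e. outside $\Omega$. A nonnegative weak solution of $$(-\Delta_{p,\mathbb{G}})^s u=\frac{\lambda f(x)}{u^{\delta}}+g(x)u^q\ \text{ in }\Omega,\qquad u=0\ \text{ in }\mathbb{G}\setminus\Omega,$$ is a function $u\in X_0^{s,p}(\Omega)$ with $u\ge 0$ a.e. in $\Omega$ such that, for every $\psi\in C_c^\infty(\Omega)$, $\int_\Omega f u^{-\delta}|\psi|\,dx<\infty$ (where $u^{-\delta}=+\infty$ at points with $u=0$; hence $u>0$ a.e. in $\Omega$) and $$\iint_{\mathbb{G}\times\mathbb{G}}\frac{|u(x)-u(y)|^{p-2}(u(x)-u(y))(\psi(x)-\psi(y))}{|y^{-1}\circ x|^{Q+ps}}\,dx\,dy-\lambda\int_\Omega f u^{-\delta}\psi\,dx-\int_\Omega g u^q\psi\,dx=0 .$$ Then every nonnegative weak solution $u\in X_0^{s,p}(\Omega)$ of this problem belongs to $L^\infty(\Omega)$. -/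

import Mathlib

open MeasureTheory Filter Topology
open scoped ContDiff ENNReal

noncomputable section

/-- `ℝ^N = ℝ^{N₁} × ⋯ × ℝ^{N_k}`, where `N_{i+1} = n i`: the coordinate `x ⟨i, l⟩` is the
`l`-th coordinate of the `(i+1)`-st layer. -/
abbrev LayeredSpace {k : ℕ} (n : Fin k → ℕ) : Type := (Σ i : Fin k, Fin (n i)) → ℝ

/-- The homogeneous dimension `Q = ∑ i N_i`. -/
def homDim {k : ℕ} (n : Fin k → ℕ) : ℕ := ∑ i : Fin k, ((i : ℕ) + 1) * n i

/-- The dilation `D_t(x) = (t x⁽¹⁾, t² x⁽²⁾, …, t^k x⁽ᵏ⁾)`. -/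
def dilation {k : ℕ} {n : Fin k → ℕ} (t : ℝ) (x : LayeredSpace n) : LayeredSpace n :=
  fun j => t ^ ((j.1 : ℕ) + 1) * x j

/-- The vector field `X_j`, invariant under the left translations of the group law `op`, whose
value at the identity `0` is `∂/∂x_j`. -/
def leftInvariantField {k : ℕ} {n : Fin k → ℕ}
    (op : LayeredSpace n → LayeredSpace n → LayeredSpace n) (j : Σ i : Fin k, Fin (n i)) :
    LayeredSpace n → LayeredSpace n :=
  fun x => fderiv ℝ (op x) 0 (Pi.single j 1)

/-- The iterated commutators of the left-invariant fields `X₁, …, X_{N₁}` of the first layer. -/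
inductive IsIteratedCommutator {k : ℕ} {n : Fin k → ℕ}
    (op : LayeredSpace n → LayeredSpace n → LayeredSpace n) :
    (LayeredSpace n → LayeredSpace n) → Prop
  | horizontal (j : Σ i : Fin k, Fin (n i)) (hj : (j.1 : ℕ) = 0) :
      IsIteratedCommutator op (leftInvariantField op j)
  | bracket (V W : LayeredSpace n → LayeredSpace n)
      (hV : IsIteratedCommutator op V) (hW : IsIteratedCommutator op W) :
      IsIteratedCommutator op (VectorField.lieBracket ℝ V W)

/-- A stratified Lie group (homogeneous Carnot group) on `ℝ^{N₁} × ⋯ × ℝ^{N_k}`: a smooth group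
law with identity `0` for which all dilations are automorphisms and such that the first layer
satisfies the Hörmander rank condition at every point. Its Haar measure is the Lebesgue measure
`volume`. -/
structure StratifiedLieGroup {k : ℕ} (n : Fin k → ℕ) where
  op : LayeredSpace n → LayeredSpace n → LayeredSpace n
  inv : LayeredSpace n → LayeredSpace n
  op_assoc : ∀ x y z, op (op x y) z = op x (op y z)
  zero_op : ∀ x, op 0 x = x
  op_zero : ∀ x, op x 0 = x
  inv_op : ∀ x, op (inv x) x = 0
  op_inv : ∀ x, op x (inv x) = 0
  contDiff_op : ContDiff ℝ ∞ fun z : LayeredSpace n × LayeredSpace n => op z.1 z.2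
  contDiff_inv : ContDiff ℝ ∞ inv
  dilation_op : ∀ t : ℝ, 0 < t → ∀ x y, dilation t (op x y) = op (dilation t x) (dilation t y)
  hormander : ∀ x : LayeredSpace n,
    Submodule.span ℝ {v : LayeredSpace n | ∃ V, IsIteratedCommutator op V ∧ V x = v} = ⊤

/-- A homogeneous quasi-norm `|·|` on a stratified Lie group. -/
structure HomogeneousQuasiNorm {k : ℕ} {n : Fin k → ℕ} (G : StratifiedLieGroup n) where
  toFun : LayeredSpace n → ℝ
  continuous_toFun : Continuous toFun
  nonneg : ∀ x, 0 ≤ toFun x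
  eq_zero_iff : ∀ x, toFun x = 0 ↔ x = 0
  map_inv : ∀ x, toFun (G.inv x) = toFun x
  map_dilation : ∀ t : ℝ, 0 < t → ∀ x, toFun (dilation t x) = t * toFun x

/-- The kernel `|y⁻¹ ∘ x|^{Q + ps}`. -/
def gagliardoKernel {k : ℕ} {n : Fin k → ℕ} {G : StratifiedLieGroup n}
    (ν : HomogeneousQuasiNorm G) (s p : ℝ) (x y : LayeredSpace n) : ℝ :=
  ν.toFun (G.op (G.inv y) x) ^ ((homDim n : ℝ) + p * s)

/-- The Gagliardo seminorm `[u]_{s,p,𝔾}`, with values in `[0, ∞]`. -/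
def gagliardoSeminorm {k : ℕ} {n : Fin k → ℕ} {G : StratifiedLieGroup n}
    (ν : HomogeneousQuasiNorm G) (s p : ℝ) (u : LayeredSpace n → ℝ) : ℝ≥0∞ :=
  (∫⁻ z : LayeredSpace n × LayeredSpace n,
    ENNReal.ofReal (|u z.1 - u z.2| ^ p / gagliardoKernel ν s p z.1 z.2)) ^ (1 / p)

/-- `φ ∈ C_c^∞(Ω)`, extended by zero. -/
def IsTestFunction {k : ℕ} {n : Fin k → ℕ} (Ω : Set (LayeredSpace n))
    (φ : LayeredSpace n → ℝ) : Prop :=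
  ContDiff ℝ ∞ φ ∧ HasCompactSupport φ ∧ tsupport φ ⊆ Ω

/-- `u ∈ X₀^{s,p}(Ω)`: the closure of `C_c^∞(Ω)` for the norm `‖u‖_{L^p(Ω)} + [u]_{s,p,𝔾}`. Its
elements are functions on `𝔾` that vanish (almost everywhere) outside `Ω`. -/
def MemX0 {k : ℕ} {n : Fin k → ℕ} {G : StratifiedLieGroup n}
    (ν : HomogeneousQuasiNorm G) (s p : ℝ) (Ω : Set (LayeredSpace n))
    (u : LayeredSpace n → ℝ) : Prop :=
  AEStronglyMeasurable u volume ∧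
  (∀ᵐ x ∂volume.restrict Ωᶜ, u x = 0) ∧
  ∃ φ : ℕ → LayeredSpace n → ℝ, (∀ m, IsTestFunction Ω (φ m)) ∧
    Tendsto (fun m => eLpNorm (fun x => u x - φ m x) (ENNReal.ofReal p) (volume.restrict Ω) +
      gagliardoSeminorm ν s p (fun x => u x - φ m x)) atTop (𝓝 0)

/-- The pairing `⟨(-Δ_{p,𝔾})^s u, ψ⟩`. -/
def fracSubLaplacianPairing {k : ℕ} {n : Fin k → ℕ} {G : StratifiedLieGroup n}
    (ν : HomogeneousQuasiNorm G) (s p : ℝ) (u ψ : LayeredSpace n → ℝ) : ℝ :=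
  ∫ z : LayeredSpace n × LayeredSpace n,
    |u z.1 - u z.2| ^ (p - 2) * (u z.1 - u z.2) * (ψ z.1 - ψ z.2) / gagliardoKernel ν s p z.1 z.2

/-- `u ∈ X₀^{s,p}(Ω)` is a nonnegative weak solution of
`(-Δ_{p,𝔾})^s u = lam f u^{-δ} + g u^q` in `Ω`, `u = 0` in `𝔾 ∖ Ω`.
The field `singular_lt_top` says that the singular term is integrable against every test function;
there `u^{-δ} = +∞` where `u = 0`, so that for a positive `f` it forces `u > 0` a.e. in `Ω`. -/
structure IsNonnegWeakSolution {k : ℕ} {n : Fin k → ℕ} {G : StratifiedLieGroup n}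
    (ν : HomogeneousQuasiNorm G) (s p δ q lam : ℝ) (Ω : Set (LayeredSpace n))
    (f g u : LayeredSpace n → ℝ) : Prop where
  mem : MemX0 ν s p Ω u
  nonneg : ∀ᵐ x ∂volume.restrict Ω, 0 ≤ u x
  singular_lt_top : ∀ ψ, IsTestFunction Ω ψ →
    ∫⁻ x in Ω, ENNReal.ofReal (f x) * ENNReal.ofReal (u x) ^ (-δ) * ENNReal.ofReal |ψ x| < ⊤
  weak_eq : ∀ ψ, IsTestFunction Ω ψ →
    fracSubLaplacianPairing ν s p u ψ - lam * (∫ x in Ω, f x * u x ^ (-δ) * ψ x)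
      - ∫ x in Ω, g x * u x ^ q * ψ x = 0

end

/-!
A nonnegative solution `u` is bounded by De Giorgi's method: for large `a` the truncation
`(u - a)₊` has energy at most a multiple of `∫ u^q (u - a)₊`, since the singular term is harmless
where `u ≥ 1`, and a Sobolev inequality with an exponent `r > q + 1` turns this into a superlinear
recursion for `∫ (u - a_j)₊^r` along levels `a_j` increasing to `2K`
(`exists_ae_le_of_deGiorgi`).

The Sobolev inequality is needed only below the critical exponent, on sets of finite measure
(`exists_lintegral_rpow_le_of_gagliardoEnergy_le`). It rests on left invariance and scaling of
the Lebesgue measure: the kernel has mass at least `c |A|^{-θ}`, `θ = s p / Q`, outside any set `A`,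
so the interaction of the level sets `{|v| > 2t}` and `{|v| ≤ t}` gives
`|{|v| > 2t}| ≤ C t^{-p} [v]^p |{|v| > t}|^θ`. Iterating this from the trivial bound, the
distribution function decays with exponents `p (1 + θ + ⋯ + θ^N)`, which tend to `Q p / (Q - s p)`.
Left translations preserve the Lebesgue measure because their Jacobian is homogeneous of degree
zero and continuous at the identity (`StratifiedLieGroup.det_fderiv_op`).

The equation is only given against smooth test functions, and the weight `u^{-δ}` is not
controlled up to the boundary of `Ω`. Write `W` for the right-hand side. Testing with smooth
approximations of `|φ|` gives `∫ W |φ| ≤ [u]^{p-1} [φ]` for every test function `φ`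
(`IsWeakSolutionWith.lintegral_mul_abs_le`), so a sequence of test functions approximating `u` in
`X₀^{s,p}` also converges to `u` in `L¹(W dx)`. Composing it with smooth approximations of
`t ↦ (t - a)₊` and passing to the limit, with Fatou's lemma on the left-hand side, yields the
energy bound for `(u - a)₊` (`IsWeakSolutionWith.gagliardoEnergy_posPart_le`).
-/

/-! ### Left invariance and scaling of the Lebesgue measure -/

section Geometry

variable {k : ℕ} {n : Fin k → ℕ}

/-- The dilation `D_t` as a continuous linear map. -/
noncomputable def dilationCLM (n : Fin k → ℕ) (t : ℝ) : LayeredSpace n →L[ℝ] LayeredSpace n :=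
  ContinuousLinearMap.pi fun j => t ^ ((j.1 : ℕ) + 1) • ContinuousLinearMap.proj j

@[simp] lemma dilationCLM_apply (t : ℝ) (x : LayeredSpace n) : dilationCLM n t x = dilation t x := by
  ext j; simp [dilationCLM, dilation]

lemma det_dilationCLM (t : ℝ) : (dilationCLM n t).det = t ^ homDim n := by
  have h : ((dilationCLM n t : LayeredSpace n →L[ℝ] LayeredSpace n) :
      LayeredSpace n →ₗ[ℝ] LayeredSpace n) =
      Matrix.toLin' (Matrix.diagonal fun j : Σ i : Fin k, Fin (n i) => t ^ ((j.1 : ℕ) + 1)) := by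
    ext x j
    simp [dilationCLM, Matrix.mulVec_diagonal]
  rw [ContinuousLinearMap.det, h, LinearMap.det_toLin', Matrix.det_diagonal, Fintype.prod_sigma,
    homDim, ← Finset.prod_pow_eq_pow_sum]
  refine Finset.prod_congr rfl fun i _ => ?_
  simp [pow_mul]

lemma volume_preimage_dilation {t : ℝ} (ht : 0 < t) (A : Set (LayeredSpace n)) :
    volume (dilation t ⁻¹' A) = ENNReal.ofReal ((t ^ homDim n)⁻¹) * volume A := by
  have h := Measure.addHaar_preimage_continuousLinearMap volume (f := dilationCLM n t)
    (by rw [← ContinuousLinearMap.det, det_dilationCLM]; positivity) A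
  rw [← ContinuousLinearMap.det, det_dilationCLM, abs_of_pos (by positivity)] at h
  rw [← h]
  congr 1

lemma dilation_one (x : LayeredSpace n) : dilation 1 x = x := by
  ext j; simp [dilation]

lemma continuous_dilation_left (x : LayeredSpace n) : Continuous fun t : ℝ => dilation t x := by
  unfold dilation; fun_prop

namespace StratifiedLieGroup

variable (G : StratifiedLieGroup n)

lemma contDiff_op_left (x : LayeredSpace n) : ContDiff ℝ ∞ (G.op x) :=
  G.contDiff_op.comp (contDiff_const.prodMk contDiff_id)

lemma continuous_op : Continuous fun z : LayeredSpace n × LayeredSpace n => G.op z.1 z.2 :=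
  G.contDiff_op.continuous

lemma inv_op_cancel_left (x y : LayeredSpace n) : G.op (G.inv x) (G.op x y) = y := by
  rw [← G.op_assoc, G.inv_op, G.zero_op]

lemma op_inv_cancel_left (x y : LayeredSpace n) : G.op x (G.op (G.inv x) y) = y := by
  rw [← G.op_assoc, G.op_inv, G.zero_op]

lemma inv_eq_of_op_eq_zero {x y : LayeredSpace n} (h : G.op x y = 0) : G.inv x = y := by
  rw [← G.inv_op_cancel_left x y, h, G.op_zero]

lemma inv_inv_op (x y : LayeredSpace n) : G.inv (G.op (G.inv x) y) = G.op (G.inv y) x :=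
  G.inv_eq_of_op_eq_zero (by rw [G.op_assoc, G.op_inv_cancel_left, G.inv_op])

lemma continuous_det_fderiv_op :
    Continuous fun z : LayeredSpace n × LayeredSpace n => (fderiv ℝ (G.op z.1) z.2).det := by
  have h : Continuous fun z : LayeredSpace n × LayeredSpace n => fderiv ℝ (G.op z.1) z.2 := by
    have := ContDiff.fderiv (n := 0) (m := ∞) (f := fun z : LayeredSpace n × LayeredSpace n => G.op z.1)
      (g := fun z => z.2) (by
        exact G.contDiff_op.comp ((contDiff_fst.comp (contDiff_fst (𝕜 := ℝ))).prodMk contDiff_snd))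
      contDiff_snd (by simp)
    exact this.continuous
  exact ContinuousLinearMap.continuous_det.comp h

lemma det_fderiv_op_dilation {t : ℝ} (ht : 0 < t) (x y : LayeredSpace n) :
    (fderiv ℝ (G.op (dilation t x)) (dilation t y)).det = (fderiv ℝ (G.op x) y).det := by
  have hd : ∀ x, Differentiable ℝ (G.op x) := fun x => (G.contDiff_op_left x).differentiable (by simp)
  have h1 : (fun y => G.op (dilation t x) (dilationCLM n t y)) =
      fun y => dilationCLM n t (G.op x y) := by
    ext1 y; simp [G.dilation_op t ht]
  have h2 := congrArg (fun F => fderiv ℝ F y) h1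
  beta_reduce at h2
  rw [fderiv_fun_comp (𝕜 := ℝ) y (hd _).differentiableAt (dilationCLM n t).differentiableAt,
    fderiv_fun_comp (𝕜 := ℝ) y (dilationCLM n t).differentiableAt (hd _).differentiableAt] at h2
  have h3 := congrArg (fun F : LayeredSpace n →L[ℝ] LayeredSpace n => F.det) h2
  simp only [ContinuousLinearMap.fderiv, ContinuousLinearMap.det,
    ContinuousLinearMap.toLinearMap_comp, LinearMap.det_comp] at h3
  have h4 : LinearMap.det (dilationCLM n t : LayeredSpace n →ₗ[ℝ] LayeredSpace n) =
      t ^ homDim n := det_dilationCLM t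
  rw [h4, dilationCLM_apply, mul_comm] at h3
  exact mul_left_cancel₀ (by positivity) h3

/-- Left translations have Jacobian one: their Jacobian is homogeneous of degree zero and
continuous at the identity, where it equals one. -/
lemma det_fderiv_op (x y : LayeredSpace n) : (fderiv ℝ (G.op x) y).det = 1 := by
  have h1 : Tendsto (fun t : ℝ => (fderiv ℝ (G.op (dilation t x)) (dilation t y)).det)
      (𝓝[>] 0) (𝓝 (fderiv ℝ (G.op (dilation 0 x)) (dilation 0 y)).det) :=
    ((G.continuous_det_fderiv_op.comp
      ((continuous_dilation_left x).prodMk (continuous_dilation_left y))).tendsto 0).mono_left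
      nhdsWithin_le_nhds
  have h2 : Tendsto (fun t : ℝ => (fderiv ℝ (G.op (dilation t x)) (dilation t y)).det)
      (𝓝[>] 0) (𝓝 (fderiv ℝ (G.op x) y).det) := by
    refine tendsto_const_nhds.congr' ?_
    filter_upwards [self_mem_nhdsWithin] with t ht
    exact (G.det_fderiv_op_dilation ht x y).symm
  rw [tendsto_nhds_unique h2 h1]
  have h0 : ∀ z : LayeredSpace n, dilation 0 z = 0 := fun z => by ext j; simp [dilation]
  have h3 : G.op 0 = fun z => z := funext G.zero_op
  rw [h0, h0, h3, fderiv_fun_id, ContinuousLinearMap.det]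
  simp

lemma volume_image_op (x : LayeredSpace n) {A : Set (LayeredSpace n)} (hA : MeasurableSet A) :
    volume (G.op x '' A) = volume A := by
  have h := lintegral_abs_det_fderiv_eq_addHaar_image volume hA (f := G.op x)
    (f' := fun y => fderiv ℝ (G.op x) y)
    (fun y _ => ((G.contDiff_op_left x).differentiable (by simp) y).hasFDerivAt.hasFDerivWithinAt)
    (fun a _ b _ hab => by
      rw [← G.inv_op_cancel_left x a, ← G.inv_op_cancel_left x b]; exact congrArg _ hab)
  rw [← h]
  simp [G.det_fderiv_op]

/-- The Lebesgue measure is invariant under left translations. -/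
lemma measurePreserving_op (x : LayeredSpace n) : MeasurePreserving (G.op x) volume volume := by
  refine ⟨(G.contDiff_op_left x).continuous.measurable, Measure.ext fun A hA => ?_⟩
  rw [Measure.map_apply (G.contDiff_op_left x).continuous.measurable hA]
  have : G.op x ⁻¹' A = G.op (G.inv x) '' A := by
    ext y
    constructor
    · intro hy
      exact ⟨_, hy, G.inv_op_cancel_left x y⟩
    · rintro ⟨z, hz, rfl⟩
      simpa [G.op_inv_cancel_left] using hz
  rw [this, G.volume_image_op _ hA]

end StratifiedLieGroup

namespace HomogeneousQuasiNorm

variable {G : StratifiedLieGroup n} (ν : HomogeneousQuasiNorm G)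

lemma map_zero : ν.toFun 0 = 0 := (ν.eq_zero_iff 0).2 rfl

lemma pos_of_ne {x : LayeredSpace n} (hx : x ≠ 0) : 0 < ν.toFun x :=
  lt_of_le_of_ne (ν.nonneg x) fun h => hx ((ν.eq_zero_iff x).1 h.symm)

lemma volume_lt {ρ : ℝ} (hρ : 0 < ρ) :
    volume {x | ν.toFun x < ρ} = ENNReal.ofReal (ρ ^ homDim n) * volume {x | ν.toFun x < 1} := by
  have h : {x | ν.toFun x < ρ} = dilation ρ⁻¹ ⁻¹' {x | ν.toFun x < 1} := by
    ext x
    simp only [Set.mem_ofPred_eq, Set.mem_preimage, ν.map_dilation _ (inv_pos.2 hρ)]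
    rw [inv_mul_lt_iff₀ hρ, mul_one]
  rw [h, volume_preimage_dilation (inv_pos.2 hρ)]
  simp

lemma volume_unit_ball_pos : 0 < volume {x | ν.toFun x < 1} := by
  refine (isOpen_lt ν.continuous_toFun continuous_const).measure_pos _ ⟨0, ?_⟩
  simp [ν.map_zero]

/-- The unit ball of a homogeneous quasi-norm is bounded, by compactness of the unit sphere of the
sup norm. -/
lemma exists_norm_le_of_le_one : ∃ R : ℝ, 0 < R ∧ ∀ x, ν.toFun x ≤ 1 → ‖x‖ ≤ R := by
  obtain ⟨m, hm, hmS⟩ : ∃ m : ℝ, 0 < m ∧ ∀ x : LayeredSpace n, ‖x‖ = 1 → m ≤ ν.toFun x := by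
    rcases (Metric.sphere (0 : LayeredSpace n) 1).eq_empty_or_nonempty with h | h
    · refine ⟨1, one_pos, fun x hx => ?_⟩
      have : x ∈ Metric.sphere (0 : LayeredSpace n) 1 := by simpa using hx
      simp [h] at this
    · obtain ⟨x₀, hx₀, hmin⟩ := (isCompact_sphere (0 : LayeredSpace n) 1).exists_isMinOn h
        ν.continuous_toFun.continuousOn
      have hx0 : x₀ ≠ 0 := by
        rintro rfl; simp at hx₀
      exact ⟨ν.toFun x₀, ν.pos_of_ne hx0, fun x hx => hmin (by simpa using hx)⟩
  set m' := min m 1 with hm'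
  have hm'0 : 0 < m' := lt_min hm one_pos
  refine ⟨(m' ^ k)⁻¹, by positivity, fun x hx => ?_⟩
  by_cases hx1 : ‖x‖ ≤ 1
  · exact hx1.trans (one_le_inv₀ (by positivity) |>.2 (pow_le_one₀ hm'0.le (min_le_right _ _)))
  push Not at hx1
  obtain ⟨t, ht, htx⟩ : ∃ t ∈ Set.Icc (0 : ℝ) 1, ‖dilation t x‖ = 1 := by
    have hc : ContinuousOn (fun t : ℝ => ‖dilation t x‖) (Set.Icc 0 1) :=
      (continuous_dilation_left x).norm.continuousOn
    have := intermediate_value_Icc zero_le_one hc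
    refine this ⟨?_, ?_⟩
    · have h0 : dilation 0 x = 0 := by ext j; simp [dilation]
      simp [h0]
    · simpa [dilation_one] using hx1.le
  have ht0 : 0 < t := by
    rcases ht.1.eq_or_lt with h | h
    · subst h
      have h0 : dilation 0 x = 0 := by ext j; simp [dilation]
      simp [h0] at htx
    · exact h
  have hmt : m' ≤ t := by
    have h1 := hmS _ htx
    rw [ν.map_dilation t ht0] at h1
    calc m' ≤ m := min_le_left _ _
      _ ≤ t * ν.toFun x := h1
      _ ≤ t * 1 := by gcongr
      _ = t := mul_one t
  rw [pi_norm_le_iff_of_nonneg (by positivity)]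
  intro j
  have h1 : ‖dilation t x j‖ ≤ 1 := htx ▸ norm_le_pi_norm _ j
  simp only [dilation, norm_mul, norm_pow, Real.norm_of_nonneg ht0.le] at h1
  have h2 : m' ^ k ≤ t ^ ((j.1 : ℕ) + 1) :=
    (pow_le_pow_of_le_one hm'0.le (min_le_right _ _) j.1.2).trans (pow_le_pow_left₀ hm'0.le hmt _)
  rw [← one_div, le_div_iff₀ (by positivity), mul_comm]
  exact (mul_le_mul_of_nonneg_right h2 (norm_nonneg _)).trans h1

lemma volume_unit_ball_lt_top : volume {x | ν.toFun x < 1} < ⊤ := by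
  obtain ⟨R, -, h⟩ := ν.exists_norm_le_of_le_one
  refine lt_of_le_of_lt (measure_mono fun x hx => ?_) (measure_closedBall_lt_top (x := 0) (r := R))
  simpa using h x (le_of_lt hx)

/-- Near the identity a homogeneous quasi-norm dominates the Euclidean norm. -/
lemma exists_norm_le_mul : ∃ R : ℝ, 0 < R ∧ ∀ x, ν.toFun x ≤ 1 → ‖x‖ ≤ R * ν.toFun x := by
  obtain ⟨R, hR, h⟩ := ν.exists_norm_le_of_le_one
  refine ⟨R, hR, fun x hx => ?_⟩
  rcases eq_or_ne x 0 with rfl | hx0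
  · simp [ν.map_zero]
  have hν := ν.pos_of_ne hx0
  have h1 := h (dilation (ν.toFun x)⁻¹ x)
    (by rw [ν.map_dilation _ (inv_pos.2 hν), inv_mul_cancel₀ hν.ne'])
  rw [pi_norm_le_iff_of_nonneg (by positivity)]
  intro j
  have h2 := (norm_le_pi_norm _ j).trans h1
  simp only [dilation, norm_mul, norm_pow, norm_inv, Real.norm_of_nonneg hν.le] at h2
  rw [inv_pow, inv_mul_le_iff₀ (by positivity), mul_comm] at h2
  refine h2.trans (mul_le_mul_of_nonneg_left ?_ hR.le)
  exact pow_le_of_le_one hν.le hx (by simp)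

end HomogeneousQuasiNorm

end Geometry

/-! ### The Gagliardo energy of test functions -/

section Energy

variable {k : ℕ} {n : Fin k → ℕ} {G : StratifiedLieGroup n} (ν : HomogeneousQuasiNorm G)

/-- A power of the quasi-norm on a dyadic annulus. -/
lemma lintegral_rpow_annulus_le (e : ℝ) {ρ : ℝ} (hρ : 0 < ρ) :
    ∫⁻ x in {x | ρ ≤ ν.toFun x ∧ ν.toFun x ≤ 2 * ρ}, ENNReal.ofReal (ν.toFun x ^ e) ≤
      ENNReal.ofReal (2 ^ |e| * 4 ^ homDim n * ρ ^ (e + homDim n)) *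
        volume {x | ν.toFun x < 1} := by
  have h1 : ∀ x ∈ {x | ρ ≤ ν.toFun x ∧ ν.toFun x ≤ 2 * ρ},
      ENNReal.ofReal (ν.toFun x ^ e) ≤ ENNReal.ofReal (2 ^ |e| * ρ ^ e) := by
    rintro x ⟨hx1, hx2⟩
    refine ENNReal.ofReal_le_ofReal ?_
    rcases le_total 0 e with he | he
    · rw [abs_of_nonneg he, ← Real.mul_rpow (by norm_num) hρ.le]
      exact Real.rpow_le_rpow (ν.nonneg x) hx2 he
    · calc ν.toFun x ^ e ≤ ρ ^ e := Real.rpow_le_rpow_of_nonpos hρ hx1 he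
        _ ≤ 2 ^ |e| * ρ ^ e := le_mul_of_one_le_left (by positivity)
            (Real.one_le_rpow (by norm_num) (abs_nonneg e))
  calc ∫⁻ x in {x | ρ ≤ ν.toFun x ∧ ν.toFun x ≤ 2 * ρ}, ENNReal.ofReal (ν.toFun x ^ e)
      ≤ ∫⁻ x in {x | ρ ≤ ν.toFun x ∧ ν.toFun x ≤ 2 * ρ}, ENNReal.ofReal (2 ^ |e| * ρ ^ e) :=
        setLIntegral_mono measurable_const h1
    _ = ENNReal.ofReal (2 ^ |e| * ρ ^ e) *
        volume {x | ρ ≤ ν.toFun x ∧ ν.toFun x ≤ 2 * ρ} := by simp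
    _ ≤ ENNReal.ofReal (2 ^ |e| * ρ ^ e) * volume {x | ν.toFun x < 4 * ρ} := by
        gcongr; exact fun h => h.2.trans_lt (by linarith)
    _ = _ := by
        rw [ν.volume_lt (by positivity), ← mul_assoc, ← ENNReal.ofReal_mul (by positivity)]
        congr 2
        rw [Real.rpow_add hρ, Real.rpow_natCast, mul_pow]
        ring

/-- Over dyadic annuli of radii `ρ₀ r^j` the integrals of a power of the quasi-norm are dominated by a
geometric series. -/
lemma lintegral_rpow_lt_top_of_annuli (e r : ℝ) (hr0 : 0 < r) (hr : r ^ (e + homDim n) < 1)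
    {ρ₀ : ℝ} (hρ₀ : 0 < ρ₀) {A : Set (LayeredSpace n)}
    (hA : ∀ x ∈ A, ∃ j : ℕ, ρ₀ * r ^ j ≤ ν.toFun x ∧ ν.toFun x ≤ 2 * (ρ₀ * r ^ j)) :
    ∫⁻ x in A, ENNReal.ofReal (ν.toFun x ^ e) < ⊤ := by
  have hsub : A ⊆ ⋃ j : ℕ, {x | ρ₀ * r ^ j ≤ ν.toFun x ∧ ν.toFun x ≤ 2 * (ρ₀ * r ^ j)} :=
    fun x hx => Set.mem_iUnion.2 (hA x hx)
  have hb : ∀ j : ℕ, ENNReal.ofReal (2 ^ |e| * 4 ^ homDim n * (ρ₀ * r ^ j) ^ (e + homDim n)) *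
      volume {x | ν.toFun x < 1} =
      ENNReal.ofReal (2 ^ |e| * 4 ^ homDim n * ρ₀ ^ (e + homDim n)) * volume {x | ν.toFun x < 1} *
        ENNReal.ofReal (r ^ (e + homDim n)) ^ j := by
    intro j
    rw [Real.mul_rpow hρ₀.le (by positivity), ← ENNReal.ofReal_pow (by positivity),
      mul_right_comm (ENNReal.ofReal _), ← ENNReal.ofReal_mul (by positivity),
      ← Real.rpow_natCast r, ← Real.rpow_natCast (r ^ _), ← Real.rpow_mul hr0.le,
      ← Real.rpow_mul hr0.le, mul_comm (j : ℝ)]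
    ring_nf
  calc ∫⁻ x in A, ENNReal.ofReal (ν.toFun x ^ e)
      ≤ ∫⁻ x in ⋃ j : ℕ, {x | ρ₀ * r ^ j ≤ ν.toFun x ∧ ν.toFun x ≤ 2 * (ρ₀ * r ^ j)},
          ENNReal.ofReal (ν.toFun x ^ e) := lintegral_mono_set hsub
    _ ≤ ∑' j : ℕ, ∫⁻ x in {x | ρ₀ * r ^ j ≤ ν.toFun x ∧ ν.toFun x ≤ 2 * (ρ₀ * r ^ j)},
          ENNReal.ofReal (ν.toFun x ^ e) := lintegral_iUnion_le _ _
    _ ≤ ∑' j : ℕ, ENNReal.ofReal (2 ^ |e| * 4 ^ homDim n * ρ₀ ^ (e + homDim n)) *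
          volume {x | ν.toFun x < 1} * ENNReal.ofReal (r ^ (e + homDim n)) ^ j :=
        ENNReal.tsum_le_tsum fun j =>
          (lintegral_rpow_annulus_le ν e (by positivity)).trans_eq (hb j)
    _ < ⊤ := by
        rw [ENNReal.tsum_mul_left, ENNReal.tsum_geometric]
        refine ENNReal.mul_lt_top (ENNReal.mul_lt_top ENNReal.ofReal_lt_top
          ν.volume_unit_ball_lt_top) ?_
        rw [ENNReal.inv_lt_top, tsub_pos_iff_lt]
        simpa using hr

lemma lintegral_rpow_one_le_lt_top {e : ℝ} (he : e + homDim n < 0) :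
    ∫⁻ x in {x | 1 ≤ ν.toFun x}, ENNReal.ofReal (ν.toFun x ^ e) < ⊤ := by
  refine lintegral_rpow_lt_top_of_annuli ν e 2 two_pos
    (Real.rpow_lt_one_of_one_lt_of_neg one_lt_two he) one_pos fun x hx => ?_
  obtain ⟨j, h1, h2⟩ := exists_nat_pow_near (show 1 ≤ ν.toFun x from hx) one_lt_two
  exact ⟨j, by simpa using h1, by rw [one_mul, ← pow_succ']; exact h2.le⟩

lemma lintegral_rpow_lt_one_lt_top {e : ℝ} (he : 0 < e + homDim n) :
    ∫⁻ x in {x | 0 < ν.toFun x ∧ ν.toFun x < 1}, ENNReal.ofReal (ν.toFun x ^ e) < ⊤ := by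
  refine lintegral_rpow_lt_top_of_annuli ν e (1 / 2) (by norm_num)
    (Real.rpow_lt_one (by norm_num) (by norm_num) he) (ρ₀ := 1 / 2) (by norm_num) fun x hx => ?_
  obtain ⟨j, h1, h2⟩ := exists_nat_pow_near_of_lt_one hx.1 hx.2.le (y := 1 / 2) (by norm_num)
    (by norm_num)
  refine ⟨j, by rw [← pow_succ']; exact h1.le, ?_⟩
  rwa [← mul_assoc, mul_one_div_cancel two_ne_zero, one_mul]

/-- The Gagliardo measure `dx dy / |y⁻¹ ∘ x|^{Q + ps}` on `𝔾 × 𝔾`. On the diagonal, where the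
kernel vanishes, the density takes the value `0⁻¹ = 0`; increments vanish there anyway. -/
noncomputable def gagliardoMeasure (s p : ℝ) : Measure (LayeredSpace n × LayeredSpace n) :=
  volume.withDensity fun z => ENNReal.ofReal (gagliardoKernel ν s p z.1 z.2)⁻¹

/-- The `p`-th power of the Gagliardo seminorm. -/
noncomputable def gagliardoEnergy (s p : ℝ) (u : LayeredSpace n → ℝ) : ℝ≥0∞ :=
  ∫⁻ z, ENNReal.ofReal (|u z.1 - u z.2| ^ p) ∂gagliardoMeasure ν s p

variable {s p : ℝ}

lemma gagliardoKernel_nonneg (x y : LayeredSpace n) : 0 ≤ gagliardoKernel ν s p x y :=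
  Real.rpow_nonneg (ν.nonneg _) _

lemma toFun_inv_op_comm (x y : LayeredSpace n) :
    ν.toFun (G.op (G.inv y) x) = ν.toFun (G.op (G.inv x) y) := by
  rw [← ν.map_inv, G.inv_inv_op]

lemma continuous_toFun_inv_op :
    Continuous fun z : LayeredSpace n × LayeredSpace n => ν.toFun (G.op (G.inv z.2) z.1) :=
  ν.continuous_toFun.comp
    (G.continuous_op.comp ((G.contDiff_inv.continuous.comp continuous_snd).prodMk continuous_fst))

lemma measurable_gagliardoKernel :
    Measurable fun z : LayeredSpace n × LayeredSpace n => gagliardoKernel ν s p z.1 z.2 :=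
  (continuous_toFun_inv_op ν).measurable.pow_const _

lemma gagliardoEnergy_eq (u : LayeredSpace n → ℝ) :
    gagliardoEnergy ν s p u = ∫⁻ z : LayeredSpace n × LayeredSpace n,
      ENNReal.ofReal (|u z.1 - u z.2| ^ p / gagliardoKernel ν s p z.1 z.2) := by
  rw [gagliardoEnergy, gagliardoMeasure, lintegral_withDensity_eq_lintegral_mul_non_measurable _
    (f := fun z : LayeredSpace n × LayeredSpace n =>
      ENNReal.ofReal (gagliardoKernel ν s p z.1 z.2)⁻¹)
    (measurable_gagliardoKernel ν).inv.ennreal_ofReal (by simp)]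
  refine lintegral_congr fun z => ?_
  simp only [Pi.mul_apply, div_eq_inv_mul]
  rw [ENNReal.ofReal_mul (inv_nonneg.2 (gagliardoKernel_nonneg ν _ _))]

lemma gagliardoSeminorm_eq (u : LayeredSpace n → ℝ) :
    gagliardoSeminorm ν s p u = gagliardoEnergy ν s p u ^ (1 / p) := by
  rw [gagliardoEnergy_eq, gagliardoSeminorm]

/-- Test functions have finite Gagliardo energy: the difference quotient is bounded near the
diagonal, and the kernel is integrable away from it. -/
lemma gagliardoEnergy_lt_top_of_isTestFunction (hs0 : 0 < s) (hs1 : s < 1) (hp : 1 < p)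
    {Ω : Set (LayeredSpace n)} {φ : LayeredSpace n → ℝ} (hφ : IsTestFunction Ω φ) :
    gagliardoEnergy ν s p φ < ⊤ := by
  obtain ⟨hφ1, hφ2, -⟩ := hφ
  set S := tsupport φ with hS
  have hScomp : IsCompact S := hφ2
  obtain ⟨R, hR, hνR⟩ := ν.exists_norm_le_mul
  obtain ⟨M, hM⟩ := hφ2.exists_bound_of_continuous hφ1.continuous
  have hM0 : 0 ≤ M := (norm_nonneg _).trans (hM 0)
  -- the increments of `φ` along `h ↦ y ∘ h` are Lipschitz, uniformly for `y` in the support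
  have hlip : ∃ L : ℝ, 0 ≤ L ∧ ∀ y ∈ S, ∀ h, ‖h‖ ≤ R → |φ (G.op y h) - φ y| ≤ L * ‖h‖ := by
    have h1 : ContDiff ℝ 1 fun z : LayeredSpace n × LayeredSpace n => φ (G.op z.1 z.2) :=
      (hφ1.comp G.contDiff_op).of_le (by simp)
    obtain ⟨L, hL⟩ := (h1.locallyLipschitz.locallyLipschitzOn
      (s := S ×ˢ Metric.closedBall 0 R)).exists_lipschitzOnWith_of_compact
      (hScomp.prod (isCompact_closedBall _ _))
    refine ⟨L, L.2, fun y hy h hh => ?_⟩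
    have := hL.dist_le_mul (y, h) ⟨hy, by simpa using hh⟩ (y, 0) ⟨hy, by simpa using hR.le⟩
    simpa [Prod.dist_eq, G.op_zero, Real.dist_eq] using this
  obtain ⟨L, hL0, hL⟩ := hlip
  set D : ℝ := (L * R) ^ p + (2 * M) ^ p with hD
  have hD1 : 0 ≤ (L * R) ^ p := by positivity
  have hD2 : 0 ≤ (2 * M) ^ p := by positivity
  set N1 := {x : LayeredSpace n | 0 < ν.toFun x ∧ ν.toFun x < 1} with hN1
  set N2 := {x : LayeredSpace n | 1 ≤ ν.toFun x} with hN2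
  have hN1m : MeasurableSet N1 := (measurableSet_lt measurable_const
    ν.continuous_toFun.measurable).inter (measurableSet_lt ν.continuous_toFun.measurable
      measurable_const)
  have hN2m : MeasurableSet N2 := measurableSet_le measurable_const ν.continuous_toFun.measurable
  set H : LayeredSpace n → ℝ≥0∞ := fun h => ENNReal.ofReal D *
    (N1.indicator (fun h => ENNReal.ofReal (ν.toFun h ^ (p - (homDim n + p * s)))) h +
      N2.indicator (fun h => ENNReal.ofReal (ν.toFun h ^ (-(homDim n + p * s)))) h) with hH
  have hHm : Measurable H := by
    have hν := ν.continuous_toFun.measurable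
    exact (((hν.pow_const _).ennreal_ofReal.indicator hN1m).add
      ((hν.pow_const _).ennreal_ofReal.indicator hN2m)).const_mul _
  have hHfin : ∫⁻ h, H h < ⊤ := by
    rw [hH, lintegral_const_mul' _ _ ENNReal.ofReal_ne_top, lintegral_add_left,
      lintegral_indicator hN1m, lintegral_indicator hN2m]
    · refine ENNReal.mul_lt_top ENNReal.ofReal_lt_top (ENNReal.add_lt_top.2 ⟨?_, ?_⟩)
      · refine lintegral_rpow_lt_one_lt_top ν ?_
        nlinarith
      · refine lintegral_rpow_one_le_lt_top ν ?_
        nlinarith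
    · exact (ν.continuous_toFun.measurable.pow_const _).ennreal_ofReal.indicator hN1m
  have key : ∀ y ∈ S, ∀ x, ENNReal.ofReal (|φ x - φ y| ^ p / gagliardoKernel ν s p x y) ≤
      H (G.op (G.inv y) x) := by
    intro y hy x
    set h := G.op (G.inv y) x with hh
    have hx : x = G.op y h := (G.op_inv_cancel_left y x).symm
    have hK : gagliardoKernel ν s p x y = ν.toFun h ^ ((homDim n : ℝ) + p * s) := rfl
    rcases (ν.nonneg h).eq_or_lt with h0 | h0
    · have : h = 0 := (ν.eq_zero_iff h).1 h0.symm
      rw [hx, this, G.op_zero]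
      simp [Real.zero_rpow (by linarith : p ≠ 0)]
    rw [hK]
    rcases lt_or_ge (ν.toFun h) 1 with h1 | h1
    · have hm : h ∈ N1 := ⟨h0, h1⟩
      have hm2 : h ∉ N2 := fun h' => absurd h1 (not_lt.2 h')
      simp only [hH, Set.indicator_of_mem hm, Set.indicator_of_notMem hm2, add_zero]
      rw [← ENNReal.ofReal_mul (by positivity)]
      refine ENNReal.ofReal_le_ofReal ?_
      rw [Real.rpow_sub h0, ← mul_div_assoc]
      gcongr
      have h2 : |φ x - φ y| ≤ L * R * ν.toFun h := by
        rw [hx]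
        have h3 := hνR h h1.le
        calc |φ (G.op y h) - φ y| ≤ L * ‖h‖ := hL y hy h (h3.trans (by nlinarith))
          _ ≤ L * (R * ν.toFun h) := by gcongr
          _ = _ := by ring
      calc |φ x - φ y| ^ p ≤ (L * R * ν.toFun h) ^ p := by gcongr
        _ = (L * R) ^ p * ν.toFun h ^ p := Real.mul_rpow (by positivity) h0.le
        _ ≤ D * ν.toFun h ^ p := by gcongr; linarith
    · have hm : h ∉ N1 := fun h' => absurd h'.2 (not_lt.2 h1)
      have hm2 : h ∈ N2 := h1
      simp only [hH, Set.indicator_of_mem hm2, Set.indicator_of_notMem hm, zero_add]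
      rw [← ENNReal.ofReal_mul (by positivity)]
      refine ENNReal.ofReal_le_ofReal ?_
      rw [Real.rpow_neg h0.le, ← div_eq_mul_inv]
      gcongr
      have h2 : |φ x - φ y| ≤ 2 * M := by
        have h3 := hM x
        have h4 := hM y
        rw [Real.norm_eq_abs] at h3 h4
        calc |φ x - φ y| ≤ |φ x| + |φ y| := abs_sub _ _
          _ ≤ 2 * M := by linarith
      calc |φ x - φ y| ^ p ≤ (2 * M) ^ p := by gcongr
        _ ≤ D := by linarith
  have hSm : MeasurableSet S := (isClosed_tsupport φ).measurableSet
  have hcont1 : Measurable fun z : LayeredSpace n × LayeredSpace n => H (G.op (G.inv z.2) z.1) :=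
    hHm.comp (G.continuous_op.comp
      ((G.contDiff_inv.continuous.comp continuous_snd).prodMk continuous_fst)).measurable
  have hcont2 : Measurable fun z : LayeredSpace n × LayeredSpace n => H (G.op (G.inv z.1) z.2) :=
    hHm.comp (G.continuous_op.comp
      ((G.contDiff_inv.continuous.comp continuous_fst).prodMk continuous_snd)).measurable
  set F1 : LayeredSpace n × LayeredSpace n → ℝ≥0∞ := fun z =>
    S.indicator (fun _ => (1 : ℝ≥0∞)) z.1 * H (G.op (G.inv z.1) z.2) with hF1
  set F2 : LayeredSpace n × LayeredSpace n → ℝ≥0∞ := fun z =>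
    S.indicator (fun _ => (1 : ℝ≥0∞)) z.2 * H (G.op (G.inv z.2) z.1) with hF2
  have hF1m : Measurable F1 :=
    ((measurable_const.indicator hSm).comp measurable_fst).mul hcont2
  have hF2m : Measurable F2 :=
    ((measurable_const.indicator hSm).comp measurable_snd).mul hcont1
  have hle : ∀ z : LayeredSpace n × LayeredSpace n,
      ENNReal.ofReal (|φ z.1 - φ z.2| ^ p / gagliardoKernel ν s p z.1 z.2) ≤ F1 z + F2 z := by
    rintro ⟨x, y⟩
    by_cases hy : y ∈ S
    · refine le_add_left ?_
      simpa [hF2, hy] using key y hy x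
    by_cases hx : x ∈ S
    · refine le_add_right ?_
      have := key x hx y
      rw [abs_sub_comm, gagliardoKernel, toFun_inv_op_comm] at this
      simpa [hF1, hx, gagliardoKernel] using this
    · have h1 : φ x = 0 := image_eq_zero_of_notMem_tsupport hx
      have h2 : φ y = 0 := image_eq_zero_of_notMem_tsupport hy
      simp [h1, h2, Real.zero_rpow (by linarith : p ≠ 0)]
  have hF1i : ∫⁻ z, F1 z = volume S * ∫⁻ h, H h := by
    rw [Measure.volume_eq_prod, lintegral_prod _ hF1m.aemeasurable]
    simp only [hF1]
    have : ∀ x : LayeredSpace n, ∫⁻ y, S.indicator (fun _ => (1 : ℝ≥0∞)) x *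
        H (G.op (G.inv x) y) = S.indicator (fun _ => (1 : ℝ≥0∞)) x * ∫⁻ h, H h := by
      intro x
      rw [lintegral_const_mul (f := fun y => H (G.op (G.inv x) y)) _
        (hHm.comp (G.contDiff_op_left _).continuous.measurable),
        (G.measurePreserving_op _).lintegral_comp hHm]
    simp_rw [this]
    rw [lintegral_mul_const _ (measurable_const.indicator hSm), lintegral_indicator hSm]
    simp
  have hF2i : ∫⁻ z, F2 z = volume S * ∫⁻ h, H h := by
    rw [← hF1i, Measure.volume_eq_prod, ← lintegral_prod_swap]
    rfl
  rw [gagliardoEnergy_eq]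
  calc _ ≤ ∫⁻ z, (F1 z + F2 z) := lintegral_mono hle
    _ = (volume S * ∫⁻ h, H h) + (volume S * ∫⁻ h, H h) := by
        rw [lintegral_add_left hF1m, hF1i, hF2i]
    _ < ⊤ := by
        have := ENNReal.mul_lt_top (hScomp.measure_lt_top (μ := volume)) hHfin
        exact ENNReal.add_lt_top.2 ⟨this, this⟩

end Energy

/-! ### The subcritical fractional Sobolev inequality -/

section Sobolev

variable {k : ℕ} {n : Fin k → ℕ} {G : StratifiedLieGroup n} (ν : HomogeneousQuasiNorm G)
  {s p : ℝ}

/-- The mass of the kernel outside a set of small measure is large: half of the ball around `x`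
whose volume is twice that of the set lies outside the set. -/
lemma exists_le_lintegral_compl_kernel (hs0 : 0 < s) (hp : 1 < p) (hQ : 0 < homDim n) :
    ∃ c : ℝ, 0 < c ∧ ∀ (A : Set (LayeredSpace n)) (x : LayeredSpace n) (m : ℝ), 0 < m →
      MeasurableSet A → volume A ≤ ENNReal.ofReal m →
      ENNReal.ofReal (c * m ^ (-(s * p / homDim n))) ≤
        ∫⁻ y in Aᶜ, ENNReal.ofReal (gagliardoKernel ν s p x y)⁻¹ := by
  have hQ' : (0 : ℝ) < homDim n := by exact_mod_cast hQ
  set V := volume {x | ν.toFun x < 1} with hV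
  have hVtop : V ≠ ⊤ := ν.volume_unit_ball_lt_top.ne
  have hv : 0 < V.toReal := ENNReal.toReal_pos ν.volume_unit_ball_pos.ne' hVtop
  set v := V.toReal
  have hne : Nonempty (Σ i : Fin k, Fin (n i)) := by
    by_contra hcon
    rw [not_nonempty_iff] at hcon
    have : homDim n = 0 := by
      rw [homDim]
      refine Finset.sum_eq_zero fun i _ => ?_
      have : n i = 0 := by
        by_contra hi
        exact hcon.false ⟨i, ⟨0, Nat.pos_of_ne_zero hi⟩⟩
      simp [this]
    omega
  set θ := s * p / homDim n with hθ
  refine ⟨(2 / v) ^ (-(1 + θ)), by positivity, fun A x m hm hA hAm => ?_⟩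
  set ρ := (2 * m / v) ^ ((homDim n : ℝ)⁻¹) with hρ
  have hρ0 : 0 < ρ := by positivity
  have hρQ : ρ ^ homDim n = 2 * m / v := by
    rw [hρ, ← Real.rpow_natCast, ← Real.rpow_mul (by positivity), inv_mul_cancel₀ hQ'.ne',
      Real.rpow_one]
  set B := {y | ν.toFun (G.op (G.inv x) y) < ρ} with hB
  have hBvol : volume B = ENNReal.ofReal (2 * m) := by
    have hBm : MeasurableSet {y | ν.toFun y < ρ} :=
      measurableSet_lt ν.continuous_toFun.measurable measurable_const
    have h1 := (G.measurePreserving_op (G.inv x)).measure_preimage hBm.nullMeasurableSet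
    have h2 : B = G.op (G.inv x) ⁻¹' {y | ν.toFun y < ρ} := rfl
    rw [h2, h1, ν.volume_lt hρ0, hρQ, ← hV, ← ENNReal.ofReal_toReal hVtop,
      ← ENNReal.ofReal_mul (by positivity)]
    congr 1
    exact div_mul_cancel₀ _ hv.ne'
  have hBm : MeasurableSet B := measurableSet_lt
    (ν.continuous_toFun.comp (G.contDiff_op_left _).continuous).measurable measurable_const
  have hdiff : ENNReal.ofReal m ≤ volume (B \ insert x A) := by
    have h0 : volume (insert x A) ≤ volume A := by
      rw [Set.insert_eq]
      simpa using measure_union_le (μ := volume) {x} A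
    have h1 : volume B - volume (insert x A) ≤ volume (B \ insert x A) := le_measure_sdiff
    refine le_trans ?_ h1
    have h2 := h0.trans hAm
    rw [hBvol]
    refine ENNReal.le_sub_of_add_le_right (h2.trans_lt ENNReal.ofReal_lt_top).ne ?_
    calc _ ≤ ENNReal.ofReal m + ENNReal.ofReal m := by gcongr
      _ = ENNReal.ofReal (2 * m) := by rw [← ENNReal.ofReal_add hm.le hm.le, two_mul]
  have hDm : MeasurableSet (B \ insert x A) := hBm.diff (hA.insert x)
  have hval : (2 / v) ^ (-(1 + θ)) * m ^ (-θ) = (ρ ^ ((homDim n : ℝ) + p * s))⁻¹ * m := by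
    rw [hρ, ← Real.rpow_mul (by positivity)]
    have : (homDim n : ℝ)⁻¹ * (homDim n + p * s) = 1 + θ := by rw [hθ]; field_simp
    rw [this, ← Real.rpow_neg (by positivity), mul_div_right_comm, Real.mul_rpow (by positivity)
      hm.le, mul_assoc]
    congr 1
    rw [show -θ = -(1 + θ) + 1 by ring, Real.rpow_add hm, Real.rpow_one]
  rw [hval, ENNReal.ofReal_mul (by positivity)]
  calc ENNReal.ofReal (ρ ^ ((homDim n : ℝ) + p * s))⁻¹ * ENNReal.ofReal m
      ≤ ENNReal.ofReal (ρ ^ ((homDim n : ℝ) + p * s))⁻¹ * volume (B \ insert x A) := by gcongr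
    _ = ∫⁻ y in B \ insert x A, ENNReal.ofReal (ρ ^ ((homDim n : ℝ) + p * s))⁻¹ := by simp
    _ ≤ ∫⁻ y in B \ insert x A, ENNReal.ofReal (gagliardoKernel ν s p x y)⁻¹ := by
        refine setLIntegral_mono' hDm fun y hy => ENNReal.ofReal_le_ofReal ?_
        have hyB : ν.toFun (G.op (G.inv x) y) < ρ := hy.1
        have hpos : 0 < ν.toFun (G.op (G.inv x) y) := by
          refine ν.pos_of_ne fun h => hy.2 (Or.inl ?_)
          have := G.op_inv_cancel_left x y
          rw [h, G.op_zero] at this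
          exact this.symm
        rw [gagliardoKernel, toFun_inv_op_comm]
        gcongr
    _ ≤ ∫⁻ y in Aᶜ, ENNReal.ofReal (gagliardoKernel ν s p x y)⁻¹ :=
        lintegral_mono_set fun y hy h => hy.2 (Or.inr h)

lemma gagliardoEnergy_congr_ae {u v : LayeredSpace n → ℝ} (h : u =ᵐ[volume] v) :
    gagliardoEnergy ν s p u = gagliardoEnergy ν s p v := by
  rw [gagliardoEnergy_eq, gagliardoEnergy_eq]
  refine lintegral_congr_ae ?_
  have h1 : ∀ᵐ z : LayeredSpace n × LayeredSpace n, u z.1 = v z.1 :=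
    Measure.quasiMeasurePreserving_fst.ae h
  have h2 : ∀ᵐ z : LayeredSpace n × LayeredSpace n, u z.2 = v z.2 :=
    Measure.quasiMeasurePreserving_snd.ae h
  filter_upwards [h1, h2] with z hz1 hz2
  rw [hz1, hz2]

lemma measurable_gagliardoDensity :
    Measurable fun z : LayeredSpace n × LayeredSpace n =>
      ENNReal.ofReal (gagliardoKernel ν s p z.1 z.2)⁻¹ :=
  (measurable_gagliardoKernel ν).inv.ennreal_ofReal

/-- Interactions between the level sets `{|v| > 2t}` and `{|v| ≤ t}` bound the energy from below. -/
lemma exists_volume_superlevel_le (hs0 : 0 < s) (hp : 1 < p) (hQ : 0 < homDim n) :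
    ∃ c : ℝ, 0 < c ∧ ∀ (v : LayeredSpace n → ℝ), Measurable v → ∀ T m t : ℝ, 0 < T → 0 < m →
      0 < t → gagliardoEnergy ν s p v ≤ ENNReal.ofReal (T ^ p) →
      volume {x | t < |v x|} ≤ ENNReal.ofReal m →
      volume {x | 2 * t < |v x|} ≤
        ENNReal.ofReal (c * (T / t) ^ p * m ^ (s * p / homDim n)) := by
  obtain ⟨c, hc, H⟩ := exists_le_lintegral_compl_kernel ν hs0 hp hQ
  refine ⟨c⁻¹, inv_pos.2 hc, fun v hv T m t hT hm ht hE hvol => ?_⟩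
  set θ := s * p / homDim n
  set A := {x | t < |v x|} with hA
  have hvabs : Measurable fun x => |v x| := hv.abs
  have hAm : MeasurableSet A := measurableSet_lt measurable_const hvabs
  set A2 := {x | 2 * t < |v x|} with hA2
  have hA2m : MeasurableSet A2 := measurableSet_lt measurable_const hvabs
  have h1 : ENNReal.ofReal (t ^ p) * ENNReal.ofReal (c * m ^ (-θ)) * volume A2 ≤
      gagliardoEnergy ν s p v := by
    have hFm : Measurable fun z : LayeredSpace n × LayeredSpace n =>
        ENNReal.ofReal (|v z.1 - v z.2| ^ p / gagliardoKernel ν s p z.1 z.2) := by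
      have h2 : Measurable fun z : LayeredSpace n × LayeredSpace n => |v z.1 - v z.2| :=
        ((hv.comp measurable_fst).sub (hv.comp measurable_snd)).abs
      exact ((h2.pow_const p).div (measurable_gagliardoKernel ν)).ennreal_ofReal
    rw [gagliardoEnergy_eq, Measure.volume_eq_prod, lintegral_prod _ hFm.aemeasurable]
    calc _ = ∫⁻ x in A2, ENNReal.ofReal (t ^ p) * ENNReal.ofReal (c * m ^ (-θ)) := by simp
      _ ≤ ∫⁻ x in A2, ∫⁻ y in Aᶜ, ENNReal.ofReal (t ^ p) *
            ENNReal.ofReal (gagliardoKernel ν s p x y)⁻¹ := by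
          refine setLIntegral_mono' hA2m fun x hx => ?_
          rw [lintegral_const_mul' _ _ ENNReal.ofReal_ne_top]
          gcongr
          exact H A x m hm hAm hvol
      _ ≤ ∫⁻ x in A2, ∫⁻ y in Aᶜ,
            ENNReal.ofReal (|v x - v y| ^ p / gagliardoKernel ν s p x y) := by
          refine setLIntegral_mono' hA2m fun x hx => setLIntegral_mono' hAm.compl fun y hy => ?_
          rw [← ENNReal.ofReal_mul (by positivity), ← div_eq_mul_inv]
          refine ENNReal.ofReal_le_ofReal ?_
          have := gagliardoKernel_nonneg ν (s := s) (p := p) x y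
          gcongr
          have hx' : 2 * t < |v x| := hx
          have hy' : |v y| ≤ t := not_lt.1 hy
          linarith [abs_sub_abs_le_abs_sub (v x) (v y)]
      _ ≤ ∫⁻ x, ∫⁻ y, ENNReal.ofReal (|v x - v y| ^ p / gagliardoKernel ν s p x y) :=
          (setLIntegral_le_lintegral _ _).trans
            (lintegral_mono fun x => setLIntegral_le_lintegral _ _)
  rw [← ENNReal.ofReal_mul (by positivity)] at h1
  have h2 : 0 < t ^ p * (c * m ^ (-θ)) := by positivity
  have h3 := (ENNReal.le_div_iff_mul_le (Or.inl (by simpa using h2)) (Or.inl (by simp))).2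
    ((mul_comm _ _).trans_le (h1.trans hE))
  refine h3.trans_eq ?_
  rw [← ENNReal.ofReal_div_of_pos h2]
  congr 1
  rw [Real.rpow_neg hm.le, Real.div_rpow hT.le ht.le]
  field_simp

/-- Iterating the level set estimate improves the decay exponent of the distribution function from
`p σ` to `p (1 + θ σ)`, where `θ = s p / Q`. -/
lemma exists_volume_superlevel_le_geom (hs0 : 0 < s) (hp : 1 < p) (hQ : 0 < homDim n)
    {m₀ : ℝ} (hm₀ : 0 < m₀) (N : ℕ) :
    ∃ C : ℝ, 0 < C ∧ ∀ (v : LayeredSpace n → ℝ), Measurable v → ∀ T : ℝ, 0 < T →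
      gagliardoEnergy ν s p v ≤ ENNReal.ofReal (T ^ p) →
      volume {x | v x ≠ 0} ≤ ENNReal.ofReal m₀ → ∀ t : ℝ, 0 < t →
      volume {x | t < |v x|} ≤
        ENNReal.ofReal (C * (T / t) ^ (p * ∑ i ∈ Finset.range N, (s * p / homDim n) ^ i)) := by
  obtain ⟨c, hc, H⟩ := exists_volume_superlevel_le ν hs0 hp hQ
  set θ := s * p / homDim n
  induction N with
  | zero =>
    refine ⟨m₀, hm₀, fun v hv T hT hE hvol t ht => ?_⟩
    simp only [Finset.range_zero, Finset.sum_empty, mul_zero, Real.rpow_zero, mul_one]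
    refine le_trans (measure_mono fun x (hx : t < |v x|) => ?_) hvol
    exact abs_pos.1 (ht.trans hx)
  | succ N ih =>
    obtain ⟨C, hC, ih⟩ := ih
    set σ := ∑ i ∈ Finset.range N, θ ^ i with hσ
    refine ⟨c * C ^ θ * 2 ^ (p * (θ * σ + 1)), by positivity, fun v hv T hT hE hvol t ht => ?_⟩
    have h1 := H v hv T (C * (T / (t / 2)) ^ (p * σ)) (t / 2) hT (by positivity) (by positivity) hE
      (ih v hv T hT hE hvol _ (by positivity))
    rw [mul_div_cancel₀ _ (two_ne_zero)] at h1
    refine h1.trans_eq ?_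
    congr 1
    rw [geom_sum_succ, ← hσ, show T / (t / 2) = 2 * (T / t) by field_simp,
      Real.mul_rpow hC.le (by positivity), ← Real.rpow_mul (by positivity),
      show p * (θ * σ + 1) = p + p * σ * θ by ring, Real.rpow_add two_pos,
      Real.rpow_add (by positivity : 0 < T / t), Real.mul_rpow two_pos.le (by positivity),
      Real.mul_rpow two_pos.le (by positivity)]
    ring

/-- A function whose distribution function is bounded by `C (T / t)^e` on a set of finite measure
lies in `L^r` for `r < e`. -/
lemma lintegral_rpow_le_of_superlevel_le {α : Type*} [MeasurableSpace α] {μ : Measure α}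
    {v : α → ℝ} (hv : Measurable v) {m₀ C T e r : ℝ} (hm₀ : 0 < m₀) (hC : 0 < C) (hT : 0 < T)
    (hr : 0 < r) (hre : r < e)
    (h0 : ∀ t : ℝ, 0 < t → μ {x | t < |v x|} ≤ ENNReal.ofReal m₀)
    (h1 : ∀ t : ℝ, 0 < t → μ {x | t < |v x|} ≤ ENNReal.ofReal (C * (T / t) ^ e)) :
    ∫⁻ x, ENNReal.ofReal (|v x| ^ r) ∂μ ≤
      ENNReal.ofReal ((m₀ + r * C / (e - r)) * T ^ r) := by
  rw [lintegral_rpow_eq_lintegral_meas_lt_mul μ (ae_of_all _ fun x => abs_nonneg _)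
    hv.abs.aemeasurable hr]
  have hsplit : Set.Ioi (0 : ℝ) = Set.Ioc 0 T ∪ Set.Ioi T := (Set.Ioc_union_Ioi_eq_Ioi hT.le).symm
  have hA : ∫⁻ t in Set.Ioc 0 T, μ {x | t < |v x|} * ENNReal.ofReal (t ^ (r - 1)) ≤
      ENNReal.ofReal (m₀ * (T ^ r / r)) := by
    have hint : IntegrableOn (fun t : ℝ => t ^ (r - 1)) (Set.Ioc 0 T) :=
      (intervalIntegrable_iff_integrableOn_Ioc_of_le hT.le).1
        (intervalIntegral.intervalIntegrable_rpow' (by linarith))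
    calc _ ≤ ∫⁻ t in Set.Ioc 0 T, ENNReal.ofReal m₀ * ENNReal.ofReal (t ^ (r - 1)) :=
          setLIntegral_mono' measurableSet_Ioc fun t ht => by gcongr; exact h0 t ht.1
      _ = ENNReal.ofReal m₀ * ENNReal.ofReal (T ^ r / r) := by
          rw [lintegral_const_mul' _ _ ENNReal.ofReal_ne_top,
            ← ofReal_integral_eq_lintegral_ofReal hint, ← intervalIntegral.integral_of_le hT.le,
            integral_rpow (Or.inl (by linarith))]
          · simp [Real.zero_rpow hr.ne']
          · filter_upwards [ae_restrict_mem measurableSet_Ioc] with t ht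
            exact Real.rpow_nonneg ht.1.le _
      _ = _ := (ENNReal.ofReal_mul hm₀.le).symm
  have hB : ∫⁻ t in Set.Ioi T, μ {x | t < |v x|} * ENNReal.ofReal (t ^ (r - 1)) ≤
      ENNReal.ofReal (C * T ^ r / (e - r)) := by
    have hint : IntegrableOn (fun t : ℝ => t ^ (r - e - 1)) (Set.Ioi T) :=
      integrableOn_Ioi_rpow_of_lt (by linarith) hT
    calc _ ≤ ∫⁻ t in Set.Ioi T, ENNReal.ofReal (C * T ^ e) * ENNReal.ofReal (t ^ (r - e - 1)) := by
          refine setLIntegral_mono' measurableSet_Ioi fun t ht => ?_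
          have ht0 : 0 < t := hT.trans ht
          calc _ ≤ ENNReal.ofReal (C * (T / t) ^ e) * ENNReal.ofReal (t ^ (r - 1)) := by
                gcongr; exact h1 t ht0
            _ = _ := by
                rw [← ENNReal.ofReal_mul (by positivity), ← ENNReal.ofReal_mul (by positivity)]
                congr 1
                rw [Real.div_rpow hT.le ht0.le, show r - e - 1 = (r - 1) - e by ring,
                  Real.rpow_sub ht0 (r - 1)]
                ring
      _ = ENNReal.ofReal (C * T ^ e) * ENNReal.ofReal (T ^ (r - e) / (e - r)) := by
          rw [lintegral_const_mul' _ _ ENNReal.ofReal_ne_top,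
            ← ofReal_integral_eq_lintegral_ofReal hint, integral_Ioi_rpow_of_lt (by linarith) hT]
          · congr 2
            rw [sub_add_cancel, ← neg_sub e r, div_neg, neg_div, neg_neg]
          · filter_upwards [ae_restrict_mem measurableSet_Ioi] with t ht
            exact Real.rpow_nonneg (hT.trans ht).le _
      _ = _ := by
          rw [← ENNReal.ofReal_mul (by positivity)]
          congr 1
          rw [Real.rpow_sub hT]
          field_simp
  have her : 0 < e - r := by linarith
  rw [hsplit]
  calc _ ≤ ENNReal.ofReal r * (ENNReal.ofReal (m₀ * (T ^ r / r)) +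
        ENNReal.ofReal (C * T ^ r / (e - r))) := by
        gcongr
        exact (lintegral_union_le _ _ _).trans (add_le_add hA hB)
    _ = _ := by
        rw [← ENNReal.ofReal_add (by positivity) (by positivity), ← ENNReal.ofReal_mul hr.le]
        congr 1
        field_simp

/-- The subcritical fractional Sobolev inequality on functions supported in a set of finite
measure. -/
theorem exists_lintegral_rpow_le_of_gagliardoEnergy_le (hs0 : 0 < s) (hp : 1 < p)
    (hsp : s * p < homDim n) {Ω : Set (LayeredSpace n)} (hΩ : volume Ω < ⊤) {r : ℝ} (hr : 0 < r)
    (hr' : r < (homDim n : ℝ) * p / ((homDim n : ℝ) - s * p)) :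
    ∃ C : ℝ, 0 < C ∧ ∀ v : LayeredSpace n → ℝ, AEStronglyMeasurable v volume →
      (∀ᵐ x ∂volume.restrict Ωᶜ, v x = 0) → ∀ T : ℝ, 0 < T →
      gagliardoEnergy ν s p v ≤ ENNReal.ofReal (T ^ p) →
      ∫⁻ x in Ω, ENNReal.ofReal (|v x| ^ r) ≤ ENNReal.ofReal (C * T ^ r) := by
  have hQ' : (0 : ℝ) < homDim n := lt_trans (by positivity) hsp
  have hQ : 0 < homDim n := by exact_mod_cast hQ'
  set θ := s * p / homDim n with hθ
  have hθ0 : 0 ≤ θ := by positivity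
  have hθ1 : θ < 1 := (div_lt_one hQ').2 hsp
  obtain ⟨N, hN⟩ : ∃ N : ℕ, r < p * ∑ i ∈ Finset.range N, θ ^ i := by
    have h1 : Tendsto (fun N => p * ∑ i ∈ Finset.range N, θ ^ i) atTop (𝓝 (p * (1 - θ)⁻¹)) :=
      (hasSum_geometric_of_lt_one hθ0 hθ1).tendsto_sum_nat.const_mul p
    have h2 : r < p * (1 - θ)⁻¹ := by
      refine hr'.trans_eq ?_
      rw [hθ]
      have : (homDim n : ℝ) - s * p ≠ 0 := by linarith
      field_simp
    exact (h1.eventually (lt_mem_nhds h2)).exists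
  set m₀ := (volume Ω).toReal + 1
  have hm₀ : 0 < m₀ := by positivity
  obtain ⟨C, hC, H⟩ := exists_volume_superlevel_le_geom ν hs0 hp hQ hm₀ N
  refine ⟨m₀ + r * C / (p * ∑ i ∈ Finset.range N, θ ^ i - r), ?_, fun v hv hvΩ T hT hE => ?_⟩
  · have := sub_pos.2 hN
    positivity
  obtain ⟨w, hw, hvw⟩ : ∃ w, Measurable w ∧ v =ᵐ[volume] w :=
    ⟨hv.mk v, hv.stronglyMeasurable_mk.measurable, hv.ae_eq_mk⟩
  rw [gagliardoEnergy_congr_ae ν hvw] at hE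
  have hsupp : volume {x | w x ≠ 0} ≤ ENNReal.ofReal m₀ := by
    have h1 : volume {x | w x ≠ 0} ≤ volume Ω := by
      refine measure_mono_ae ?_
      have h2 := ae_imp_of_ae_restrict hvΩ
      filter_upwards [h2, hvw] with x hx1 hx2 hx3
      by_contra hx4
      exact hx3 (hx2 ▸ hx1 hx4)
    refine h1.trans ?_
    rw [← ENNReal.ofReal_toReal hΩ.ne]
    exact ENNReal.ofReal_le_ofReal (by simp [m₀])
  calc ∫⁻ x in Ω, ENNReal.ofReal (|v x| ^ r) ≤ ∫⁻ x, ENNReal.ofReal (|v x| ^ r) :=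
        setLIntegral_le_lintegral _ _
    _ = ∫⁻ x, ENNReal.ofReal (|w x| ^ r) := lintegral_congr_ae (by
        filter_upwards [hvw] with x hx
        rw [hx])
    _ ≤ _ := by
      refine lintegral_rpow_le_of_superlevel_le hw hm₀ hC hT hr hN (fun t ht => ?_)
        (H w hw T hT hE hsupp)
      refine le_trans (measure_mono fun x (hx : t < |w x|) => ?_) hsupp
      exact abs_pos.1 (ht.trans hx)

end Sobolev

/-! ### Smooth approximations of truncations -/

section Approximation

/-- A smooth approximation of `|t - a| - |a|` that vanishes at `0` and is `1`-Lipschitz. -/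
noncomputable def smoothAbs (a ε t : ℝ) : ℝ := √((t - a) ^ 2 + ε ^ 2) - √(a ^ 2 + ε ^ 2)

lemma contDiff_smoothAbs (a : ℝ) {ε : ℝ} (hε : 0 < ε) : ContDiff ℝ ∞ (smoothAbs a ε) := by
  unfold smoothAbs
  refine (ContDiff.sqrt (by fun_prop) fun t => ?_).sub contDiff_const
  positivity

lemma smoothAbs_zero (a ε : ℝ) : smoothAbs a ε 0 = 0 := by simp [smoothAbs]

lemma abs_sqrt_sub_sqrt_le (ε b c : ℝ) : |√(b ^ 2 + ε ^ 2) - √(c ^ 2 + ε ^ 2)| ≤ |b - c| := by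
  -- the triangle inequality for the Euclidean norm of `(b, ε)` and `(c, ε)`
  have h := abs_norm_sub_norm_le (⟨b, ε⟩ : ℂ) ⟨c, ε⟩
  have h2 : ‖(⟨b, ε⟩ : ℂ) - ⟨c, ε⟩‖ = |b - c| := by
    rw [Complex.norm_def, Complex.normSq_apply]
    simp [← Real.sqrt_sq_eq_abs, sq]
  rw [h2, Complex.norm_def, Complex.norm_def, Complex.normSq_apply, Complex.normSq_apply] at h
  simpa [sq] using h

lemma abs_smoothAbs_sub_le (a ε b c : ℝ) : |smoothAbs a ε b - smoothAbs a ε c| ≤ |b - c| := by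
  have h := abs_sqrt_sub_sqrt_le ε (b - a) (c - a)
  simpa [smoothAbs] using h

lemma tendsto_smoothAbs (a t : ℝ) :
    Tendsto (fun ε => smoothAbs a ε t) (𝓝 0) (𝓝 (|t - a| - |a|)) := by
  have h : Continuous fun ε => smoothAbs a ε t := by unfold smoothAbs; fun_prop
  simpa [smoothAbs, Real.sqrt_sq_eq_abs] using h.tendsto 0

/-- A smooth approximation of `max (t - a) 0` (for `a ≥ 0`) that vanishes at `0`, is nondecreasing
and `1`-Lipschitz. -/
noncomputable def smoothPosPart (a ε t : ℝ) : ℝ := (t + smoothAbs a ε t) / 2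

lemma contDiff_smoothPosPart (a : ℝ) {ε : ℝ} (hε : 0 < ε) :
    ContDiff ℝ ∞ (smoothPosPart a ε) := by
  unfold smoothPosPart
  exact (contDiff_id.add (contDiff_smoothAbs a hε)).div_const 2

lemma smoothPosPart_zero (a ε : ℝ) : smoothPosPart a ε 0 = 0 := by
  simp [smoothPosPart, smoothAbs_zero]

lemma abs_smoothPosPart_sub_le (a ε b c : ℝ) :
    |smoothPosPart a ε b - smoothPosPart a ε c| ≤ |b - c| := by
  have h := abs_smoothAbs_sub_le a ε b c
  have h2 : smoothPosPart a ε b - smoothPosPart a ε c =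
      ((b - c) + (smoothAbs a ε b - smoothAbs a ε c)) / 2 := by unfold smoothPosPart; ring
  rw [h2, abs_div, abs_two]
  linarith [abs_add_le (b - c) (smoothAbs a ε b - smoothAbs a ε c)]

lemma tendsto_smoothPosPart {a : ℝ} (ha : 0 ≤ a) (t : ℝ) :
    Tendsto (fun ε => smoothPosPart a ε t) (𝓝 0) (𝓝 (max (t - a) 0)) := by
  have h := ((tendsto_smoothAbs a t).const_add t).div_const 2
  have h2 : max (t - a) 0 = (t + (|t - a| - |a|)) / 2 := by
    rw [abs_of_nonneg ha]
    rcases le_total 0 (t - a) with h | h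
    · rw [max_eq_left h, abs_of_nonneg h]; ring
    · rw [max_eq_right h, abs_of_nonpos h]; ring
  rw [h2]
  exact h

/-- The monotonicity inequality `|b - c|^{p-2} (b - c) (b' - c') ≥ |b' - c'|^p` for the positive
parts `b' = (b - a)₊` and `c' = (c - a)₊`. -/
lemma abs_posPart_sub_rpow_le {p : ℝ} (hp : 1 < p) (a b c : ℝ) :
    |max (b - a) 0 - max (c - a) 0| ^ p ≤
      |b - c| ^ (p - 2) * (b - c) * (max (b - a) 0 - max (c - a) 0) := by
  rcases eq_or_ne b c with rfl | hbc
  · simp [Real.zero_rpow (by linarith : p ≠ 0)]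
  have hpos : 0 < |b - c| := abs_pos.2 (sub_ne_zero.2 hbc)
  set d := max (b - a) 0 - max (c - a) 0 with hd
  have h1 : |d| ≤ |b - c| := by
    have := abs_max_sub_max_le_abs (b - a) (c - a) 0
    simpa using this
  have h2 : (b - c) * d = |b - c| * |d| := by
    rw [← abs_mul]
    refine (abs_of_nonneg ?_).symm
    rcases le_total b c with h | h
    · have : d ≤ 0 := sub_nonpos.2 (max_le_max (by linarith) le_rfl)
      exact mul_nonneg_of_nonpos_of_nonpos (by linarith) this
    · have : 0 ≤ d := sub_nonneg.2 (max_le_max (by linarith) le_rfl)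
      exact mul_nonneg (by linarith) this
  rw [mul_assoc, h2, ← mul_assoc]
  have h3 : |b - c| ^ (p - 2) * |b - c| = |b - c| ^ (p - 1) := by
    rw [← Real.rpow_add_one hpos.ne']
    congr 1; ring
  rw [h3]
  rcases (abs_nonneg d).eq_or_lt with h | h
  · rw [← h]; simp [Real.zero_rpow (by linarith : p ≠ 0)]
  calc |d| ^ p = |d| ^ (p - 1) * |d| := by
        rw [← Real.rpow_add_one h.ne']; congr 1; ring
    _ ≤ |b - c| ^ (p - 1) * |d| := by
        gcongr

variable {k : ℕ} {n : Fin k → ℕ} {Ω : Set (LayeredSpace n)}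

lemma IsTestFunction.comp {φ : LayeredSpace n → ℝ} (hφ : IsTestFunction Ω φ) {F : ℝ → ℝ}
    (hF : ContDiff ℝ ∞ F) (hF0 : F 0 = 0) : IsTestFunction Ω fun x => F (φ x) :=
  ⟨hF.comp hφ.1, hφ.2.1.comp_left hF0, (tsupport_comp_subset hF0 φ).trans hφ.2.2⟩

lemma IsTestFunction.sub {φ ψ : LayeredSpace n → ℝ} (hφ : IsTestFunction Ω φ)
    (hψ : IsTestFunction Ω ψ) : IsTestFunction Ω fun x => φ x - ψ x :=
  ⟨hφ.1.sub hψ.1, hφ.2.1.sub hψ.2.1,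
    (tsupport_sub φ ψ).trans (Set.union_subset hφ.2.2 hψ.2.2)⟩

end Approximation

/-! ### The Gagliardo seminorm and the space `X₀` -/

section Seminorm

variable {k : ℕ} {n : Fin k → ℕ} {G : StratifiedLieGroup n} (ν : HomogeneousQuasiNorm G)
  {s p : ℝ} {Ω : Set (LayeredSpace n)}

lemma gagliardoMeasure_ae {P : LayeredSpace n → Prop} (h : ∀ᵐ x, P x) :
    ∀ᵐ z ∂gagliardoMeasure ν s p, P z.1 ∧ P z.2 := by
  refine (withDensity_absolutelyContinuous _ _).ae_le ?_
  have h1 : ∀ᵐ z : LayeredSpace n × LayeredSpace n, P z.1 :=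
    Measure.quasiMeasurePreserving_fst.ae h
  have h2 : ∀ᵐ z : LayeredSpace n × LayeredSpace n, P z.2 :=
    Measure.quasiMeasurePreserving_snd.ae h
  exact h1.and h2

lemma aestronglyMeasurable_increment {u : LayeredSpace n → ℝ}
    (hu : AEStronglyMeasurable u volume) :
    AEStronglyMeasurable (fun z : LayeredSpace n × LayeredSpace n => u z.1 - u z.2)
      (gagliardoMeasure ν s p) :=
  AEStronglyMeasurable.mono_ac (withDensity_absolutelyContinuous _ _)
    ((hu.comp_quasiMeasurePreserving Measure.quasiMeasurePreserving_fst).sub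
      (hu.comp_quasiMeasurePreserving Measure.quasiMeasurePreserving_snd))

lemma gagliardoSeminorm_eq_eLpNorm (hp : 1 < p) (u : LayeredSpace n → ℝ) :
    gagliardoSeminorm ν s p u =
      eLpNorm (fun z : LayeredSpace n × LayeredSpace n => u z.1 - u z.2) (ENNReal.ofReal p)
        (gagliardoMeasure ν s p) := by
  have hp0 : 0 < p := by linarith
  rw [gagliardoSeminorm_eq, eLpNorm_eq_lintegral_rpow_enorm_toReal (by simpa using hp0) (by simp),
    ENNReal.toReal_ofReal hp0.le, gagliardoEnergy]
  congr 1
  refine lintegral_congr fun z => ?_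
  rw [← ENNReal.ofReal_rpow_of_nonneg (abs_nonneg _) hp0.le, Real.enorm_eq_ofReal_abs]

lemma gagliardoSeminorm_lt_top_of_isTestFunction (hs0 : 0 < s) (hs1 : s < 1) (hp : 1 < p)
    {φ : LayeredSpace n → ℝ} (hφ : IsTestFunction Ω φ) : gagliardoSeminorm ν s p φ < ⊤ := by
  rw [gagliardoSeminorm_eq]
  exact ENNReal.rpow_lt_top_of_nonneg (by positivity)
    (gagliardoEnergy_lt_top_of_isTestFunction ν hs0 hs1 hp hφ).ne

lemma gagliardoSeminorm_sub_le (hp : 1 < p) {u v w : LayeredSpace n → ℝ}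
    (hu : AEStronglyMeasurable u volume) (hv : AEStronglyMeasurable v volume)
    (hw : AEStronglyMeasurable w volume) :
    gagliardoSeminorm ν s p (fun x => u x - w x) ≤
      gagliardoSeminorm ν s p (fun x => u x - v x) +
        gagliardoSeminorm ν s p (fun x => v x - w x) := by
  simp only [gagliardoSeminorm_eq_eLpNorm ν hp]
  have h1 := aestronglyMeasurable_increment ν (s := s) (p := p) (hu.sub hv)
  have h2 := aestronglyMeasurable_increment ν (s := s) (p := p) (hv.sub hw)
  have h3 := eLpNorm_add_le h1 h2 (p := ENNReal.ofReal p) (by simpa using hp.le)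
  refine le_trans (le_of_eq (congrArg (fun F => eLpNorm F (ENNReal.ofReal p) _) ?_)) h3
  ext z
  simp only [Pi.add_apply, Pi.sub_apply]
  ring

lemma gagliardoSeminorm_sub_comm (u v : LayeredSpace n → ℝ) :
    gagliardoSeminorm ν s p (fun x => u x - v x) =
      gagliardoSeminorm ν s p (fun x => v x - u x) := by
  simp only [gagliardoSeminorm_eq, gagliardoEnergy]
  congr 1
  refine lintegral_congr fun z => ?_
  rw [← abs_neg]
  congr 3
  ring

lemma gagliardoSeminorm_mono (hp : 1 < p) {u v : LayeredSpace n → ℝ}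
    (h : ∀ x y, |u x - u y| ≤ |v x - v y|) :
    gagliardoSeminorm ν s p u ≤ gagliardoSeminorm ν s p v := by
  simp only [gagliardoSeminorm_eq_eLpNorm ν hp]
  exact eLpNorm_mono fun z => h z.1 z.2

/-- The defining approximation of an element of `X₀^{s,p}(Ω)`, with almost everywhere
convergence. -/
lemma MemX0.exists_seq (hp : 1 < p) {u : LayeredSpace n → ℝ} (hu : MemX0 ν s p Ω u) :
    ∃ φ : ℕ → LayeredSpace n → ℝ, (∀ m, IsTestFunction Ω (φ m)) ∧
      Tendsto (fun m => gagliardoSeminorm ν s p fun x => φ m x - u x) atTop (𝓝 0) ∧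
      ∀ᵐ x, Tendsto (fun m => φ m x) atTop (𝓝 (u x)) := by
  obtain ⟨hum, hu0, φ, hφ, hlim⟩ := hu
  have h1 : Tendsto (fun m => eLpNorm (φ m - u) (ENNReal.ofReal p) (volume.restrict Ω))
      atTop (𝓝 0) := by
    refine tendsto_of_tendsto_of_tendsto_of_le_of_le tendsto_const_nhds hlim (fun _ => zero_le)
      fun m => ?_
    rw [eLpNorm_sub_comm]
    exact le_self_add
  have h2 : Tendsto (fun m => gagliardoSeminorm ν s p fun x => φ m x - u x) atTop (𝓝 0) := by
    refine tendsto_of_tendsto_of_tendsto_of_le_of_le tendsto_const_nhds hlim (fun _ => zero_le)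
      fun m => ?_
    beta_reduce
    rw [gagliardoSeminorm_sub_comm]
    exact le_add_self
  have h3 := tendstoInMeasure_of_tendsto_eLpNorm_of_ne_top
    (by simpa using (by linarith : 0 < p)) ENNReal.ofReal_ne_top
    (fun m => (hφ m).1.continuous.aestronglyMeasurable) hum.restrict h1
  obtain ⟨ns, hns, hae⟩ := h3.exists_seq_tendsto_ae
  refine ⟨fun m => φ (ns m), fun m => hφ _, h2.comp hns.tendsto_atTop, ?_⟩
  have h4 := ae_imp_of_ae_restrict hu0
  have h5 := ae_imp_of_ae_restrict hae
  filter_upwards [h4, h5] with x hx1 hx2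
  by_cases hx : x ∈ Ω
  · exact hx2 hx
  · have : ∀ m, φ (ns m) x = 0 := fun m =>
      image_eq_zero_of_notMem_tsupport fun h => hx ((hφ _).2.2 h)
    simp [this, hx1 hx]

lemma MemX0.gagliardoSeminorm_lt_top (hs0 : 0 < s) (hs1 : s < 1) (hp : 1 < p)
    {u : LayeredSpace n → ℝ} (hu : MemX0 ν s p Ω u) : gagliardoSeminorm ν s p u < ⊤ := by
  obtain ⟨hum, -, φ, hφ, hlim⟩ := hu
  obtain ⟨m, hm⟩ := (hlim.eventually (gt_mem_nhds ENNReal.zero_lt_top)).exists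
  have h1 : gagliardoSeminorm ν s p (fun x => u x - φ m x) < ⊤ := lt_of_le_of_lt le_add_self hm
  have h2 := gagliardoSeminorm_sub_le ν (s := s) hp hum (hφ m).1.continuous.aestronglyMeasurable
    (aestronglyMeasurable_const (b := (0 : ℝ)))
  simp only [sub_zero] at h2
  exact h2.trans_lt (ENNReal.add_lt_top.2
    ⟨h1, gagliardoSeminorm_lt_top_of_isTestFunction ν hs0 hs1 hp (hφ m)⟩)

end Seminorm

/-! ### The energy inequality for truncations -/

section EnergyInequality

variable {k : ℕ} {n : Fin k → ℕ} {G : StratifiedLieGroup n} (ν : HomogeneousQuasiNorm G)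
  {s p : ℝ} {Ω : Set (LayeredSpace n)}

lemma abs_rpow_sub_two_mul_self (hp : 1 < p) (a : ℝ) : |(|a| ^ (p - 2) * a)| = |a| ^ (p - 1) := by
  rcases eq_or_ne a 0 with rfl | ha
  · simp [Real.zero_rpow (by linarith : p - 1 ≠ 0)]
  rw [abs_mul, abs_of_nonneg (by positivity), ← Real.rpow_add_one (abs_pos.2 ha).ne']
  congr 1; ring

/-- Hölder's inequality for the pairing. -/
lemma lintegral_rpow_mul_increment_le (hp : 1 < p) {u v : LayeredSpace n → ℝ}
    (hu : AEStronglyMeasurable u volume) (hv : AEStronglyMeasurable v volume) :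
    ∫⁻ z, ENNReal.ofReal (|u z.1 - u z.2| ^ (p - 1) * |v z.1 - v z.2|) ∂gagliardoMeasure ν s p ≤
      gagliardoSeminorm ν s p u ^ (p - 1) * gagliardoSeminorm ν s p v := by
  have hu' := (aestronglyMeasurable_increment ν (s := s) (p := p) hu).aemeasurable.abs
  have hv' := (aestronglyMeasurable_increment ν (s := s) (p := p) hv).aemeasurable.abs
  have hp1 : 0 < p - 1 := by linarith
  have h := ENNReal.lintegral_mul_le_Lp_mul_Lq (gagliardoMeasure ν s p)
    (Real.HolderConjugate.conjExponent hp).symm (hu'.pow_const (p - 1)).ennreal_ofReal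
    hv'.ennreal_ofReal
  simp only [Pi.mul_apply] at h
  calc _ = ∫⁻ z, ENNReal.ofReal (|u z.1 - u z.2| ^ (p - 1)) * ENNReal.ofReal |v z.1 - v z.2|
        ∂gagliardoMeasure ν s p :=
        lintegral_congr fun z => ENNReal.ofReal_mul (by positivity)
    _ ≤ _ := h
    _ = _ := by
      rw [gagliardoSeminorm_eq, gagliardoSeminorm_eq, ← ENNReal.rpow_mul]
      congr 1
      · congr 1
        · refine lintegral_congr fun z => ?_
          rw [ENNReal.ofReal_rpow_of_nonneg (by positivity)
            (by rw [Real.conjExponent]; positivity), ← Real.rpow_mul (abs_nonneg _)]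
          congr 2
          rw [Real.conjExponent]
          field_simp
        · rw [Real.conjExponent]
          field_simp
      · congr 1
        refine lintegral_congr fun z => ?_
        rw [ENNReal.ofReal_rpow_of_nonneg (by positivity) (by linarith)]

lemma integrable_rpow_mul_increment (hp : 1 < p) {u v : LayeredSpace n → ℝ}
    (hu : AEStronglyMeasurable u volume) (hv : AEStronglyMeasurable v volume)
    (hu' : gagliardoSeminorm ν s p u < ⊤) (hv' : gagliardoSeminorm ν s p v < ⊤) :
    Integrable (fun z : LayeredSpace n × LayeredSpace n =>
      |u z.1 - u z.2| ^ (p - 1) * |v z.1 - v z.2|) (gagliardoMeasure ν s p) := by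
  have hum := (aestronglyMeasurable_increment ν (s := s) (p := p) hu).aemeasurable.abs
  have hvm := (aestronglyMeasurable_increment ν (s := s) (p := p) hv).aemeasurable.abs
  refine ⟨((hum.pow_const (p - 1)).mul hvm).aestronglyMeasurable, ?_⟩
  rw [hasFiniteIntegral_iff_ofReal (ae_of_all _ fun z => by positivity)]
  refine (lintegral_rpow_mul_increment_le ν hp hu hv).trans_lt ?_
  exact ENNReal.mul_lt_top (ENNReal.rpow_lt_top_of_nonneg (by linarith) hu'.ne) hv'

lemma integrable_pairing (hp : 1 < p) {u v : LayeredSpace n → ℝ}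
    (hu : AEStronglyMeasurable u volume) (hv : AEStronglyMeasurable v volume)
    (hu' : gagliardoSeminorm ν s p u < ⊤) (hv' : gagliardoSeminorm ν s p v < ⊤) :
    Integrable (fun z : LayeredSpace n × LayeredSpace n =>
      |u z.1 - u z.2| ^ (p - 2) * (u z.1 - u z.2) * (v z.1 - v z.2))
      (gagliardoMeasure ν s p) := by
  have hum := (aestronglyMeasurable_increment ν (s := s) (p := p) hu).aemeasurable
  have hvm := (aestronglyMeasurable_increment ν (s := s) (p := p) hv).aemeasurable
  refine (integrable_rpow_mul_increment ν hp hu hv hu' hv').mono'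
    (((hum.abs.pow_const (p - 2)).mul hum).mul hvm).aestronglyMeasurable (ae_of_all _ fun z => ?_)
  rw [Real.norm_eq_abs, abs_mul, abs_rpow_sub_two_mul_self hp]

lemma fracSubLaplacianPairing_eq (u ψ : LayeredSpace n → ℝ) :
    fracSubLaplacianPairing ν s p u ψ =
      ∫ z, |u z.1 - u z.2| ^ (p - 2) * (u z.1 - u z.2) * (ψ z.1 - ψ z.2)
        ∂gagliardoMeasure ν s p := by
  rw [gagliardoMeasure, integral_withDensity_eq_integral_toReal_smul
    (measurable_gagliardoDensity ν) (by simp), fracSubLaplacianPairing]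
  refine integral_congr_ae (ae_of_all _ fun z => ?_)
  beta_reduce
  rw [ENNReal.toReal_ofReal (inv_nonneg.2 (gagliardoKernel_nonneg ν _ _)), smul_eq_mul,
    div_eq_inv_mul]

/-- The pairing with `u` is represented by `W` on test functions, that is,
`(-Δ_{p,𝔾})^s u = W` holds weakly in `Ω`, with a nonnegative right-hand side `W` that is
integrable against every test function. -/
structure IsWeakSolutionWith (s p : ℝ) (Ω : Set (LayeredSpace n))
    (u W : LayeredSpace n → ℝ) : Prop where
  nonneg : ∀ᵐ x ∂volume.restrict Ω, 0 ≤ W x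
  aemeasurable : AEMeasurable W (volume.restrict Ω)
  integrable : ∀ ψ, IsTestFunction Ω ψ → IntegrableOn (fun x => W x * ψ x) Ω
  pairing_eq : ∀ ψ, IsTestFunction Ω ψ →
    fracSubLaplacianPairing ν s p u ψ = ∫ x in Ω, W x * ψ x

variable {ν}

/-- Testing with smooth approximations of `|φ|` shows that the right-hand side of the equation is,
on nonnegative functions, a bounded functional for the Gagliardo seminorm. -/
lemma IsWeakSolutionWith.lintegral_mul_abs_le (hs0 : 0 < s) (hs1 : s < 1) (hp : 1 < p)
    {u W : LayeredSpace n → ℝ} (hu : MemX0 ν s p Ω u) (hW : IsWeakSolutionWith ν s p Ω u W)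
    {φ : LayeredSpace n → ℝ} (hφ : IsTestFunction Ω φ) :
    ∫⁻ x in Ω, ENNReal.ofReal (W x) * ENNReal.ofReal |φ x| ≤
      gagliardoSeminorm ν s p u ^ (p - 1) * gagliardoSeminorm ν s p φ := by
  set ε : ℕ → ℝ := fun j => 1 / ((j : ℝ) + 1) with hε
  have hε0 : ∀ j, 0 < ε j := fun j => by positivity
  have hεlim : Tendsto ε atTop (𝓝 0) := tendsto_one_div_add_atTop_nhds_zero_nat
  set F : ℕ → LayeredSpace n → ℝ := fun j x => smoothAbs 0 (ε j) (φ x) with hF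
  have hFt : ∀ j, IsTestFunction Ω (F j) := fun j =>
    hφ.comp (contDiff_smoothAbs 0 (hε0 j)) (smoothAbs_zero _ _)
  have hFnn : ∀ j x, 0 ≤ F j x := fun j x => by
    simp only [hF, smoothAbs, sub_zero]
    refine sub_nonneg.2 (Real.sqrt_le_sqrt ?_)
    nlinarith [sq_nonneg (φ x)]
  have hFlim : ∀ x, Tendsto (fun j => F j x) atTop (𝓝 |φ x|) := fun x => by
    simpa [Function.comp_def] using (tendsto_smoothAbs 0 (φ x)).comp hεlim
  have hbound : ∀ j, ∫⁻ x in Ω, ENNReal.ofReal (W x) * ENNReal.ofReal (F j x) ≤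
      gagliardoSeminorm ν s p u ^ (p - 1) * gagliardoSeminorm ν s p φ := by
    intro j
    have hut := hu.gagliardoSeminorm_lt_top ν hs0 hs1 hp
    have hFtop := gagliardoSeminorm_lt_top_of_isTestFunction ν hs0 hs1 hp (hFt j)
    have hFm := (hFt j).1.continuous.aestronglyMeasurable (μ := volume)
    have hi1 := integrable_pairing ν hp hu.1 hFm hut hFtop
    have hi2 := integrable_rpow_mul_increment ν hp hu.1 hFm hut hFtop
    calc ∫⁻ x in Ω, ENNReal.ofReal (W x) * ENNReal.ofReal (F j x)
        = ∫⁻ x in Ω, ENNReal.ofReal (W x * F j x) :=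
          lintegral_congr fun x => (ENNReal.ofReal_mul' (hFnn j x)).symm
      _ = ENNReal.ofReal (∫ x in Ω, W x * F j x) :=
          (ofReal_integral_eq_lintegral_ofReal (hW.integrable _ (hFt j)) (by
            filter_upwards [hW.nonneg] with x hx
            exact mul_nonneg hx (hFnn j x))).symm
      _ ≤ ENNReal.ofReal (∫ z, |u z.1 - u z.2| ^ (p - 1) * |F j z.1 - F j z.2|
            ∂gagliardoMeasure ν s p) := by
          rw [← hW.pairing_eq _ (hFt j), fracSubLaplacianPairing_eq]
          refine ENNReal.ofReal_le_ofReal (integral_mono hi1 hi2 fun z => ?_)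
          refine (le_abs_self _).trans_eq ?_
          rw [abs_mul, abs_rpow_sub_two_mul_self hp]
      _ = ∫⁻ z, ENNReal.ofReal (|u z.1 - u z.2| ^ (p - 1) * |F j z.1 - F j z.2|)
            ∂gagliardoMeasure ν s p :=
          ofReal_integral_eq_lintegral_ofReal hi2 (ae_of_all _ fun z => by positivity)
      _ ≤ gagliardoSeminorm ν s p u ^ (p - 1) * gagliardoSeminorm ν s p (F j) :=
          lintegral_rpow_mul_increment_le ν hp hu.1 hFm
      _ ≤ _ := by
          gcongr
          exact gagliardoSeminorm_mono ν hp fun x y => abs_smoothAbs_sub_le _ _ _ _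
  have hWm := hW.aemeasurable.ennreal_ofReal
  calc ∫⁻ x in Ω, ENNReal.ofReal (W x) * ENNReal.ofReal |φ x|
      = ∫⁻ x in Ω, liminf (fun j => ENNReal.ofReal (W x) * ENNReal.ofReal (F j x)) atTop := by
        refine lintegral_congr fun x => (Tendsto.liminf_eq ?_).symm
        exact ENNReal.Tendsto.const_mul (ENNReal.tendsto_ofReal (hFlim x))
          (Or.inr ENNReal.ofReal_ne_top)
    _ ≤ liminf (fun j => ∫⁻ x in Ω, ENNReal.ofReal (W x) * ENNReal.ofReal (F j x)) atTop :=
        lintegral_liminf_le' fun j => hWm.mul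
          (hFt j).1.continuous.measurable.ennreal_ofReal.aemeasurable
    _ ≤ _ := by
        refine liminf_le_of_le (by isBoundedDefault) fun b hb => ?_
        obtain ⟨j, hj⟩ := hb.exists
        exact hj.trans (hbound j)

/-- The approximating test functions converge to `u` in `L¹(W dx)` as well. -/
lemma IsWeakSolutionWith.lintegral_mul_abs_sub_le (hs0 : 0 < s) (hs1 : s < 1) (hp : 1 < p)
    {u W : LayeredSpace n → ℝ} (hu : MemX0 ν s p Ω u) (hW : IsWeakSolutionWith ν s p Ω u W)
    {φ : ℕ → LayeredSpace n → ℝ} (hφ : ∀ m, IsTestFunction Ω (φ m))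
    (hlim : Tendsto (fun m => gagliardoSeminorm ν s p fun x => φ m x - u x) atTop (𝓝 0))
    (hae : ∀ᵐ x, Tendsto (fun m => φ m x) atTop (𝓝 (u x))) (m : ℕ) :
    ∫⁻ x in Ω, ENNReal.ofReal (W x) * ENNReal.ofReal |φ m x - u x| ≤
      gagliardoSeminorm ν s p u ^ (p - 1) * gagliardoSeminorm ν s p (fun x => φ m x - u x) := by
  have hut := hu.gagliardoSeminorm_lt_top ν hs0 hs1 hp
  have hWm := hW.aemeasurable.ennreal_ofReal
  have hφm : ∀ m, AEStronglyMeasurable (φ m) volume := fun m =>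
    (hφ m).1.continuous.aestronglyMeasurable
  have hκ : gagliardoSeminorm ν s p u ^ (p - 1) ≠ ⊤ :=
    ENNReal.rpow_ne_top_of_nonneg (by linarith) hut.ne
  have hb : ∀ l, ∫⁻ x in Ω, ENNReal.ofReal (W x) * ENNReal.ofReal |φ m x - φ l x| ≤
      gagliardoSeminorm ν s p u ^ (p - 1) * (gagliardoSeminorm ν s p (fun x => φ m x - u x) +
        gagliardoSeminorm ν s p (fun x => φ l x - u x)) := by
    intro l
    refine (hW.lintegral_mul_abs_le hs0 hs1 hp hu ((hφ m).sub (hφ l))).trans ?_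
    gcongr
    rw [gagliardoSeminorm_sub_comm ν (φ l)]
    exact gagliardoSeminorm_sub_le ν hp (hφm m) hu.1 (hφm l)
  calc ∫⁻ x in Ω, ENNReal.ofReal (W x) * ENNReal.ofReal |φ m x - u x|
      = ∫⁻ x in Ω, liminf (fun l => ENNReal.ofReal (W x) * ENNReal.ofReal |φ m x - φ l x|)
          atTop := by
        refine lintegral_congr_ae ?_
        filter_upwards [ae_restrict_of_ae hae] with x hx
        refine (Tendsto.liminf_eq ?_).symm
        exact ENNReal.Tendsto.const_mul (ENNReal.tendsto_ofReal (hx.const_sub _).abs)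
          (Or.inr ENNReal.ofReal_ne_top)
    _ ≤ liminf (fun l => ∫⁻ x in Ω, ENNReal.ofReal (W x) * ENNReal.ofReal |φ m x - φ l x|)
          atTop :=
        lintegral_liminf_le' fun l => hWm.mul
          ((hφ m).sub (hφ l)).1.continuous.measurable.abs.ennreal_ofReal.aemeasurable
    _ ≤ liminf (fun l => gagliardoSeminorm ν s p u ^ (p - 1) *
          (gagliardoSeminorm ν s p (fun x => φ m x - u x) +
            gagliardoSeminorm ν s p (fun x => φ l x - u x))) atTop :=
        liminf_le_liminf (Eventually.of_forall hb)
    _ = _ := by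
        refine Tendsto.liminf_eq ?_
        have h1 := ENNReal.Tendsto.const_mul (a := gagliardoSeminorm ν s p u ^ (p - 1))
          (hlim.const_add (gagliardoSeminorm ν s p (fun x => φ m x - u x))) (Or.inr hκ)
        simpa using h1

/-- The Caccioppoli-type inequality: the truncation `(u - a)₊` is an admissible test function. -/
theorem IsWeakSolutionWith.gagliardoEnergy_posPart_le (hs0 : 0 < s) (hs1 : s < 1) (hp : 1 < p)
    {u W : LayeredSpace n → ℝ} (hu : MemX0 ν s p Ω u) (hW : IsWeakSolutionWith ν s p Ω u W)
    {a : ℝ} (ha : 0 ≤ a) :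
    gagliardoEnergy ν s p (fun x => max (u x - a) 0) ≤
      ∫⁻ x in Ω, ENNReal.ofReal (W x * max (u x - a) 0) := by
  have hut := hu.gagliardoSeminorm_lt_top ν hs0 hs1 hp
  obtain ⟨φ, hφ, hlim, hae⟩ := hu.exists_seq ν hp
  have hφm : ∀ m, AEStronglyMeasurable (φ m) volume := fun m =>
    (hφ m).1.continuous.aestronglyMeasurable
  have hWm := hW.aemeasurable
  have hum : AEMeasurable u (volume.restrict Ω) := hu.1.aemeasurable.restrict
  have hκ : gagliardoSeminorm ν s p u ^ (p - 1) ≠ ⊤ :=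
    ENNReal.rpow_ne_top_of_nonneg (by linarith) hut.ne
  have hκlim : Tendsto (fun m => gagliardoSeminorm ν s p u ^ (p - 1) *
      gagliardoSeminorm ν s p (fun x => φ m x - u x)) atTop (𝓝 0) := by
    simpa using ENNReal.Tendsto.const_mul hlim (Or.inr hκ)
  set ε : ℕ → ℝ := fun j => 1 / ((j : ℝ) + 1) with hε
  have hε0 : ∀ j, 0 < ε j := fun j => by positivity
  have hεlim : Tendsto ε atTop (𝓝 0) := tendsto_one_div_add_atTop_nhds_zero_nat
  set w : LayeredSpace n → ℝ := fun x => max (u x - a) 0 with hw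
  set ψ : ℕ → LayeredSpace n → ℝ := fun m x => smoothPosPart a (ε m) (φ m x) with hψ
  have hψt : ∀ m, IsTestFunction Ω (ψ m) := fun m =>
    (hφ m).comp (contDiff_smoothPosPart a (hε0 m)) (smoothPosPart_zero _ _)
  have hψlip : ∀ m x y, |ψ m x - ψ m y| ≤ |φ m x - φ m y| := fun m x y =>
    abs_smoothPosPart_sub_le _ _ _ _
  have hul : ∀ x, Tendsto (fun m => smoothPosPart a (ε m) (u x)) atTop (𝓝 (w x)) := fun x =>
    (tendsto_smoothPosPart ha (u x)).comp hεlim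
  have hψae : ∀ᵐ x, Tendsto (fun m => ψ m x) atTop (𝓝 (w x)) := by
    filter_upwards [hae] with x hx
    have h1 : Tendsto (fun m => ψ m x - smoothPosPart a (ε m) (u x)) atTop (𝓝 0) := by
      refine squeeze_zero_norm (a := fun m => |φ m x - u x|)
        (fun m => abs_smoothPosPart_sub_le _ _ _ _) ?_
      simpa using (hx.sub_const (u x)).abs
    simpa using h1.add (hul x)
  -- integrability of `u` against `W`
  have hWu : IntegrableOn (fun x => W x * u x) Ω := by
    have h1 : ∃ m, ∫⁻ x in Ω, ENNReal.ofReal (W x) * ENNReal.ofReal |φ m x - u x| < ⊤ := by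
      obtain ⟨m, hm⟩ := (hκlim.eventually (gt_mem_nhds ENNReal.zero_lt_top)).exists
      exact ⟨m, (hW.lintegral_mul_abs_sub_le hs0 hs1 hp hu hφ hlim hae m).trans_lt hm⟩
    obtain ⟨m, hm⟩ := h1
    have h2 : IntegrableOn (fun x => W x * (φ m x - u x)) Ω := by
      refine ⟨(hWm.mul ((hφ m).1.continuous.measurable.aemeasurable.sub hum)).aestronglyMeasurable,
        ?_⟩
      rw [hasFiniteIntegral_iff_enorm]
      refine (lintegral_mono_ae ?_).trans_lt hm
      filter_upwards [hW.nonneg] with x hx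
      rw [Real.enorm_eq_ofReal_abs, abs_mul, abs_of_nonneg hx, ENNReal.ofReal_mul hx]
    refine ((hW.integrable _ (hφ m)).sub h2).congr (ae_of_all _ fun x => ?_)
    simp only [Pi.sub_apply]
    ring
  have hwle : ∀ x, |w x| ≤ |u x| := fun x => by
    have := abs_max_sub_max_le_abs (u x - a) (0 - a) 0
    rwa [max_eq_right (by linarith : 0 - a ≤ 0), sub_zero, sub_sub_sub_cancel_right,
      sub_zero] at this
  have hwm : AEMeasurable w (volume.restrict Ω) := (hum.sub_const a).max aemeasurable_const
  have hWw : IntegrableOn (fun x => W x * w x) Ω := by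
    refine Integrable.mono hWu (hWm.mul hwm).aestronglyMeasurable (ae_of_all _ fun x => ?_)
    rw [norm_mul, norm_mul]
    gcongr
    exact hwle x
  have hsm : ∀ m, AEMeasurable (fun x => smoothPosPart a (ε m) (u x)) (volume.restrict Ω) :=
    fun m => (contDiff_smoothPosPart a (hε0 m)).continuous.measurable.comp_aemeasurable hum
  -- convergence of the right-hand sides
  have hR : Tendsto (fun m => ∫ x in Ω, W x * ψ m x) atTop (𝓝 (∫ x in Ω, W x * w x)) := by
    refine tendsto_integral_of_L1 _ hWw.aestronglyMeasurable
      (Eventually.of_forall fun m => hW.integrable _ (hψt m)) ?_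
    have h1 : Tendsto (fun m => ∫⁻ x in Ω, ‖W x * smoothPosPart a (ε m) (u x) - W x * w x‖ₑ)
        atTop (𝓝 0) := by
      have h2 : Tendsto (fun m => ∫⁻ x in Ω, ‖W x * smoothPosPart a (ε m) (u x) - W x * w x‖ₑ)
          atTop (𝓝 (∫⁻ _ in Ω, 0)) := by
        refine tendsto_lintegral_of_dominated_convergence' (fun x => ‖2 * (W x * u x)‖ₑ)
          (fun m => ((hWm.mul (hsm m)).sub (hWm.mul hwm)).enorm) (fun m => ?_)
          (hWu.const_mul 2).hasFiniteIntegral.ne ?_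
        · refine ae_of_all _ fun x => enorm_le_iff_norm_le.2 ?_
          rw [← mul_sub, norm_mul, norm_mul, norm_mul]
          have h3 : ‖smoothPosPart a (ε m) (u x) - w x‖ ≤ 2 * ‖u x‖ := by
            refine (norm_sub_le _ _).trans ?_
            have h4 := abs_smoothPosPart_sub_le a (ε m) (u x) 0
            rw [smoothPosPart_zero, sub_zero, sub_zero] at h4
            have h5 := hwle x
            rw [Real.norm_eq_abs, Real.norm_eq_abs, Real.norm_eq_abs]
            linarith
          calc ‖W x‖ * ‖smoothPosPart a (ε m) (u x) - w x‖ ≤ ‖W x‖ * (2 * ‖u x‖) := by gcongr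
            _ = _ := by rw [Real.norm_of_nonneg (zero_le_two)]; ring
        · refine ae_of_all _ fun x => ?_
          have h3 := (((hul x).const_mul (W x)).sub_const (W x * w x)).enorm
          simpa using h3
      simpa using h2
    have h2 := hκlim.add h1
    rw [add_zero] at h2
    refine tendsto_of_tendsto_of_tendsto_of_le_of_le tendsto_const_nhds h2 (fun _ => zero_le)
      fun m => ?_
    calc ∫⁻ x in Ω, ‖W x * ψ m x - W x * w x‖ₑ
        ≤ ∫⁻ x in Ω, (ENNReal.ofReal (W x) * ENNReal.ofReal |φ m x - u x| +
            ‖W x * smoothPosPart a (ε m) (u x) - W x * w x‖ₑ) := by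
          refine lintegral_mono_ae ?_
          filter_upwards [hW.nonneg] with x hx
          have h3 : W x * ψ m x - W x * w x = W x * (ψ m x - smoothPosPart a (ε m) (u x)) +
              (W x * smoothPosPart a (ε m) (u x) - W x * w x) := by ring
          rw [h3]
          refine (enorm_add_le _ _).trans ?_
          gcongr
          rw [← ENNReal.ofReal_mul hx, Real.enorm_eq_ofReal_abs, abs_mul, abs_of_nonneg hx]
          refine ENNReal.ofReal_le_ofReal (mul_le_mul_of_nonneg_left ?_ hx)
          exact abs_smoothPosPart_sub_le _ _ _ _
      _ = (∫⁻ x in Ω, ENNReal.ofReal (W x) * ENNReal.ofReal |φ m x - u x|) +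
            ∫⁻ x in Ω, ‖W x * smoothPosPart a (ε m) (u x) - W x * w x‖ₑ :=
          lintegral_add_left' (hWm.ennreal_ofReal.mul
            ((hφ m).1.continuous.measurable.aemeasurable.sub hum).abs.ennreal_ofReal) _
      _ ≤ _ := by
          gcongr
          exact hW.lintegral_mul_abs_sub_le hs0 hs1 hp hu hφ hlim hae m
  set μ := gagliardoMeasure ν s p with hμ
  have hφtop : ∀ m, gagliardoSeminorm ν s p (φ m) < ⊤ := fun m =>
    gagliardoSeminorm_lt_top_of_isTestFunction ν hs0 hs1 hp (hφ m)
  have hψtop : ∀ m, gagliardoSeminorm ν s p (ψ m) < ⊤ := fun m =>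
    gagliardoSeminorm_lt_top_of_isTestFunction ν hs0 hs1 hp (hψt m)
  have hψm : ∀ m, AEStronglyMeasurable (ψ m) volume := fun m =>
    (hψt m).1.continuous.aestronglyMeasurable
  have hwtop : gagliardoSeminorm ν s p w < ⊤ := by
    refine lt_of_le_of_lt (gagliardoSeminorm_mono ν hp fun x y => ?_) hut
    simpa using abs_max_sub_max_le_abs (u x - a) (u y - a) 0
  have hwm' : AEStronglyMeasurable w volume :=
    ((hu.1.aemeasurable.sub_const a).max aemeasurable_const).aestronglyMeasurable
  set A : LayeredSpace n × LayeredSpace n → ℝ :=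
    fun z => |u z.1 - u z.2| ^ (p - 2) * (u z.1 - u z.2) with hA
  set B : LayeredSpace n × LayeredSpace n → ℝ := fun z => |u z.1 - u z.2| ^ (p - 1) with hB
  have hAB : ∀ z, |A z| = B z := fun z => abs_rpow_sub_two_mul_self hp _
  have hB0 : ∀ z, 0 ≤ B z := fun z => (abs_nonneg _).trans_eq (hAB z)
  have hiφ : ∀ m, Integrable (fun z => B z * |φ m z.1 - φ m z.2|) μ := fun m =>
    integrable_rpow_mul_increment ν hp hu.1 (hφm m) hut (hφtop m)
  have hiu : Integrable (fun z => B z * |u z.1 - u z.2|) μ :=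
    integrable_rpow_mul_increment ν hp hu.1 hu.1 hut hut
  have hiψ : ∀ m, Integrable (fun z => A z * (ψ m z.1 - ψ m z.2)) μ := fun m =>
    integrable_pairing ν hp hu.1 (hψm m) hut (hψtop m)
  have hiw : Integrable (fun z => A z * (w z.1 - w z.2)) μ :=
    integrable_pairing ν hp hu.1 hwm' hut hwtop
  have hL : Tendsto (fun m => ∫ z, B z * |φ m z.1 - φ m z.2| ∂μ) atTop
      (𝓝 (∫ z, B z * |u z.1 - u z.2| ∂μ)) := by
    refine tendsto_integral_of_L1 _ hiu.aestronglyMeasurable (Eventually.of_forall hiφ) ?_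
    refine tendsto_of_tendsto_of_tendsto_of_le_of_le tendsto_const_nhds hκlim (fun _ => zero_le)
      fun m => ?_
    refine le_trans (lintegral_mono fun z => ?_)
      (lintegral_rpow_mul_increment_le ν hp hu.1 ((hφm m).sub hu.1))
    rw [← mul_sub, Real.enorm_eq_ofReal_abs, abs_mul, abs_of_nonneg (hB0 z)]
    refine ENNReal.ofReal_le_ofReal (mul_le_mul_of_nonneg_left ?_ (hB0 z))
    refine (abs_abs_sub_abs_le _ _).trans_eq ?_
    congr 1
    ring
  -- Fatou's lemma for the nonnegative functions `B |δφ_m| + A δψ_m`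
  have hFatou : ENNReal.ofReal (∫ z, (B z * |u z.1 - u z.2| + A z * (w z.1 - w z.2)) ∂μ) ≤
      ENNReal.ofReal (∫ z, B z * |u z.1 - u z.2| ∂μ + ∫ x in Ω, W x * w x) := by
    have hnn : ∀ (b c d : ℝ) (z : LayeredSpace n × LayeredSpace n), |c| ≤ |d| →
        0 ≤ B z * |d| + A z * c := fun b c d z h => by
      have h1 : |A z * c| ≤ B z * |d| := by
        rw [abs_mul, hAB]
        exact mul_le_mul_of_nonneg_left h (hB0 z)
      linarith [neg_abs_le (A z * c)]
    have hwlip : ∀ x y, |w x - w y| ≤ |u x - u y| := fun x y => by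
      simpa using abs_max_sub_max_le_abs (u x - a) (u y - a) 0
    have hadd : Integrable (fun z => B z * |u z.1 - u z.2| + A z * (w z.1 - w z.2)) μ :=
      hiu.add hiw
    rw [ofReal_integral_eq_lintegral_ofReal hadd
      (ae_of_all _ fun z => hnn 0 _ _ z (hwlip _ _))]
    calc ∫⁻ z, ENNReal.ofReal (B z * |u z.1 - u z.2| + A z * (w z.1 - w z.2)) ∂μ
        = ∫⁻ z, liminf (fun m => ENNReal.ofReal
            (B z * |φ m z.1 - φ m z.2| + A z * (ψ m z.1 - ψ m z.2))) atTop ∂μ := by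
          refine lintegral_congr_ae ?_
          filter_upwards [gagliardoMeasure_ae ν (hae.and hψae)] with z hz
          refine (Tendsto.liminf_eq (ENNReal.tendsto_ofReal ?_)).symm
          exact ((hz.1.1.sub hz.2.1).abs.const_mul _).add ((hz.1.2.sub hz.2.2).const_mul _)
      _ ≤ liminf (fun m => ∫⁻ z, ENNReal.ofReal
            (B z * |φ m z.1 - φ m z.2| + A z * (ψ m z.1 - ψ m z.2)) ∂μ) atTop :=
          lintegral_liminf_le' fun m => ((hiφ m).add (hiψ m)).aemeasurable.ennreal_ofReal
      _ = liminf (fun m => ENNReal.ofReal (∫ z, B z * |φ m z.1 - φ m z.2| ∂μ +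
            ∫ x in Ω, W x * ψ m x)) atTop := by
          congr 1
          ext m
          rw [← hW.pairing_eq _ (hψt m), fracSubLaplacianPairing_eq,
            ← integral_add (hiφ m) (hiψ m)]
          exact (ofReal_integral_eq_lintegral_ofReal ((hiφ m).add (hiψ m))
            (ae_of_all _ fun z => hnn 0 _ _ z (hψlip m _ _))).symm
      _ = _ := (ENNReal.tendsto_ofReal (hL.add hR)).liminf_eq
  have hw0 : ∀ x, 0 ≤ w x := fun x => le_max_right _ _
  have hWw0 : 0 ≤ᵐ[volume.restrict Ω] fun x => W x * w x := by
    filter_upwards [hW.nonneg] with x hx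
    exact mul_nonneg hx (hw0 x)
  have hmain : ∫ z, A z * (w z.1 - w z.2) ∂μ ≤ ∫ x in Ω, W x * w x := by
    have h1 : 0 ≤ ∫ z, B z * |u z.1 - u z.2| ∂μ :=
      integral_nonneg fun z => mul_nonneg (hB0 z) (abs_nonneg _)
    have h2 : 0 ≤ ∫ x in Ω, W x * w x := integral_nonneg_of_ae hWw0
    have h3 := (ENNReal.ofReal_le_ofReal_iff (by positivity)).1 hFatou
    rw [integral_add hiu hiw] at h3
    linarith
  rw [gagliardoEnergy]
  calc ∫⁻ z, ENNReal.ofReal (|w z.1 - w z.2| ^ p) ∂μ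
      ≤ ∫⁻ z, ENNReal.ofReal (A z * (w z.1 - w z.2)) ∂μ :=
        lintegral_mono fun z => ENNReal.ofReal_le_ofReal (abs_posPart_sub_rpow_le hp a _ _)
    _ = ENNReal.ofReal (∫ z, A z * (w z.1 - w z.2) ∂μ) :=
        (ofReal_integral_eq_lintegral_ofReal hiw (ae_of_all _ fun z =>
          (Real.rpow_nonneg (abs_nonneg _) _).trans (abs_posPart_sub_rpow_le hp a _ _))).symm
    _ ≤ ENNReal.ofReal (∫ x in Ω, W x * w x) := ENNReal.ofReal_le_ofReal hmain
    _ = _ := ofReal_integral_eq_lintegral_ofReal hWw hWw0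

end EnergyInequality

/-! ### De Giorgi iteration -/

section DeGiorgi

/-- Above the level `b > a` the source `u^q (u - b)₊` is controlled by `(u - a)₊^r`, because there
`u - a ≥ b - a` and `q + 1 < r`. -/
lemma rpow_mul_posPart_le {q r a b t : ℝ} (hq : 0 < q) (hqr : q + 1 < r) (ha : 0 ≤ a)
    (hab : a < b) :
    max t 0 ^ q * max (t - b) 0 ≤
      (b / (b - a)) ^ q * (b - a) ^ (-(r - q - 1)) * max (t - a) 0 ^ r := by
  have hd : 0 < b - a := sub_pos.2 hab
  have hb : 0 < b := ha.trans_lt hab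
  rcases le_or_gt t b with h | h
  · rw [max_eq_right (by linarith : t - b ≤ 0), mul_zero]
    positivity
  have hw : b - a < t - a := by linarith
  have hw0 : 0 < t - a := by linarith
  rw [max_eq_left (by linarith : 0 ≤ t - b), max_eq_left hw0.le, max_eq_left (by linarith : 0 ≤ t)]
  have h1 : t ≤ b / (b - a) * (t - a) := by
    rw [div_mul_eq_mul_div, le_div_iff₀ hd]
    nlinarith
  calc t ^ q * (t - b) ≤ (b / (b - a) * (t - a)) ^ q * (t - a) := by
        have : 0 ≤ t := by linarith
        gcongr
    _ = (b / (b - a)) ^ q * ((t - a) ^ (-(r - q - 1)) * (t - a) ^ r) := by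
        rw [Real.mul_rpow (by positivity) hw0.le, mul_assoc, ← Real.rpow_add_one hw0.ne',
          ← Real.rpow_add hw0]
        congr 2
        ring
    _ ≤ (b / (b - a)) ^ q * ((b - a) ^ (-(r - q - 1)) * (t - a) ^ r) := by
        gcongr ?_ * (?_ * ?_)
        exact Real.rpow_le_rpow_of_nonpos hd hw.le (by linarith)
    _ = _ := by ring

/-- The De Giorgi iteration. Here `e a` stands for the energy of `(u - a)₊`: it is controlled by
`u^q (u - a)₊`, and it controls the `L^r` norm of `(u - a)₊`. Along the levels
`a_j = K (2 - 2^{-j})` the integrals of `(u - a_j)₊^r` decay geometrically once `K` is large, so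
that `u ≤ 2K` almost everywhere. -/
theorem exists_ae_le_of_deGiorgi {α : Type*} [MeasurableSpace α] {μ : Measure α} {u : α → ℝ}
    (hu : AEMeasurable u μ) {p q r : ℝ} (hp : 1 < p) (hpq : p < q + 1) (hqr : q + 1 < r)
    (e : ℝ → ℝ≥0∞) {C₀ C₁ : ℝ} (hC₁ : 0 < C₁)
    (hsob : ∀ a T : ℝ, 0 ≤ a → 0 < T → e a ≤ ENNReal.ofReal (T ^ p) →
      ∫⁻ x, ENNReal.ofReal (max (u x - a) 0 ^ r) ∂μ ≤ ENNReal.ofReal (C₀ * T ^ r))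
    (hcac : ∀ a : ℝ, 1 ≤ a → e a ≤
      ∫⁻ x, ENNReal.ofReal (C₁ * (max (u x) 0 ^ q * max (u x - a) 0)) ∂μ)
    (hfin : ∫⁻ x, ENNReal.ofReal (|u x| ^ r) ∂μ < ⊤) :
    ∃ M : ℝ, ∀ᵐ x ∂μ, u x ≤ M := by
  have hq : 0 < q := by linarith
  have hr : 0 < r := by linarith
  have hp0 : 0 < p := by linarith
  set κ := r - q - 1 with hκ
  have hκ0 : 0 < κ := by rw [hκ]; linarith
  set α' := r / p with hα
  have hα1 : 1 < α' := (one_lt_div hp0).2 (by linarith)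
  set M := (∫⁻ x, ENNReal.ofReal (|u x| ^ r) ∂μ).toReal + 1 with hM
  have hM0 : 0 < M := by positivity
  set B : ℝ := 2 ^ (q + κ) with hB
  have hB0 : 0 < B := by positivity
  set D : ℝ := C₁ * M * 2 ^ (2 * q + κ) with hD
  have hD0 : 0 < D := by positivity
  -- the ratio `η` solves `(B η)^(r/p) = η`
  set η : ℝ := B ^ (-(α' / (α' - 1))) with hη
  have hη0 : 0 < η := by positivity
  have hη1 : η < 1 := by
    refine Real.rpow_lt_one_of_one_lt_of_neg (Real.one_lt_rpow one_lt_two (by linarith)) ?_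
    exact neg_neg_of_pos (div_pos (by linarith) (by linarith))
  have hBη : (B * η) ^ α' = η := by
    have h1 : α' - 1 ≠ 0 := by linarith
    rw [hη, ← Real.rpow_one_add' hB0.le, ← Real.rpow_mul hB0.le]
    · congr 1
      field_simp
      ring
    · have : 1 + -(α' / (α' - 1)) = -(1 / (α' - 1)) := by field_simp; ring
      rw [this]
      exact neg_ne_zero.2 (one_div_ne_zero h1)
  obtain ⟨K, hK1, hK⟩ : ∃ K : ℝ, 1 ≤ K ∧ C₀ * (D * K ^ (-κ)) ^ α' ≤ M * η := by
    have h1 : Tendsto (fun K : ℝ => C₀ * (D * K ^ (-κ)) ^ α') atTop (𝓝 (C₀ * (D * 0) ^ α')) :=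
      (((tendsto_rpow_neg_atTop hκ0).const_mul D).rpow_const
        (Or.inr (by linarith))).const_mul C₀
    rw [mul_zero, Real.zero_rpow (by linarith), mul_zero] at h1
    exact ((eventually_ge_atTop 1).and
      (h1.eventually (ge_mem_nhds (show 0 < M * η by positivity)))).exists
  have hK0 : 0 < K := by linarith
  set a : ℕ → ℝ := fun j => K * (2 - (2 ^ j)⁻¹) with ha
  have h2j : ∀ j : ℕ, (2 ^ j : ℝ)⁻¹ ≤ 1 := fun j => inv_le_one_of_one_le₀ (one_le_pow₀ one_le_two)
  have haK : ∀ j, K ≤ a j := fun j => le_mul_of_one_le_right hK0.le (by linarith [h2j j])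
  have ha2K : ∀ j, a j ≤ 2 * K := fun j => by
    have : (0 : ℝ) < (2 ^ j)⁻¹ := by positivity
    simp only [ha]
    nlinarith
  have had : ∀ j, a (j + 1) - a j = K * (2 ^ (j + 1))⁻¹ := fun j => by
    simp only [ha, pow_succ]
    field_simp
    ring
  have hY : ∀ j, ∫⁻ x, ENNReal.ofReal (max (u x - a j) 0 ^ r) ∂μ ≤ ENNReal.ofReal (M * η ^ j) := by
    intro j
    induction j with
    | zero =>
      calc ∫⁻ x, ENNReal.ofReal (max (u x - a 0) 0 ^ r) ∂μ
          ≤ ∫⁻ x, ENNReal.ofReal (|u x| ^ r) ∂μ := by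
            refine lintegral_mono fun x => ENNReal.ofReal_le_ofReal ?_
            have := haK 0
            gcongr
            exact max_le ((by linarith : u x - a 0 ≤ u x).trans (le_abs_self _)) (abs_nonneg _)
        _ ≤ _ := by
            rw [pow_zero, mul_one, ← ENNReal.ofReal_toReal hfin.ne]
            exact ENNReal.ofReal_le_ofReal (by rw [hM]; linarith)
    | succ j ih =>
      have hd : 0 < a (j + 1) - a j := by rw [had]; positivity
      have hcoef : (a (j + 1) / (a (j + 1) - a j)) ^ q * (a (j + 1) - a j) ^ (-κ) ≤
          2 ^ (2 * q + κ) * K ^ (-κ) * B ^ j := by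
        have h1 : a (j + 1) / (a (j + 1) - a j) ≤ 2 ^ (j + 2) := by
          rw [div_le_iff₀ hd, had]
          refine (ha2K _).trans_eq ?_
          rw [pow_succ _ (j + 1)]
          field_simp
        have h2 : (a (j + 1) - a j) ^ (-κ) = K ^ (-κ) * (2 ^ (j + 1)) ^ κ := by
          rw [had, Real.mul_rpow hK0.le (by positivity), Real.inv_rpow (by positivity),
            Real.rpow_neg (by positivity : (0 : ℝ) ≤ 2 ^ (j + 1)), inv_inv]
        have h3 : 0 ≤ a (j + 1) / (a (j + 1) - a j) :=
          div_nonneg (hK0.le.trans (haK _)) hd.le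
        calc _ ≤ ((2 : ℝ) ^ (j + 2)) ^ q * (K ^ (-κ) * (2 ^ (j + 1)) ^ κ) := by
              rw [h2]
              gcongr
          _ = _ := by
              rw [hB, ← Real.rpow_natCast, ← Real.rpow_natCast, ← Real.rpow_natCast (2 ^ (q + κ)),
                ← Real.rpow_mul two_pos.le, ← Real.rpow_mul two_pos.le, ← Real.rpow_mul two_pos.le]
              rw [mul_left_comm, ← Real.rpow_add two_pos, mul_comm (_ ^ (2 * q + κ)), mul_assoc,
                ← Real.rpow_add two_pos]
              congr 2
              push_cast
              ring
      set T := (D * K ^ (-κ) * (B * η) ^ j) ^ (1 / p) with hT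
      have hT0 : 0 < T := by positivity
      have hTp : T ^ p = D * K ^ (-κ) * (B * η) ^ j := by
        rw [hT, ← Real.rpow_mul (by positivity), one_div_mul_cancel hp0.ne', Real.rpow_one]
      have hTr : T ^ r = (D * K ^ (-κ)) ^ α' * η ^ j := by
        rw [hT, ← Real.rpow_mul (by positivity), one_div_mul_eq_div, ← hα,
          Real.mul_rpow (by positivity) (by positivity), ← Real.rpow_natCast,
          ← Real.rpow_mul (by positivity), mul_comm (j : ℝ), Real.rpow_mul (by positivity), hBη,
          Real.rpow_natCast]
      have hE : e (a (j + 1)) ≤ ENNReal.ofReal (T ^ p) := by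
        calc e (a (j + 1))
            ≤ ∫⁻ x, ENNReal.ofReal (C₁ * (max (u x) 0 ^ q * max (u x - a (j + 1)) 0)) ∂μ :=
              hcac _ (hK1.trans (haK _))
          _ ≤ ∫⁻ x, ENNReal.ofReal (C₁ * (2 ^ (2 * q + κ) * K ^ (-κ) * B ^ j)) *
                ENNReal.ofReal (max (u x - a j) 0 ^ r) ∂μ := by
              refine lintegral_mono fun x => ?_
              rw [← ENNReal.ofReal_mul (by positivity)]
              refine ENNReal.ofReal_le_ofReal ?_
              rw [mul_assoc]
              refine mul_le_mul_of_nonneg_left ?_ hC₁.le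
              refine (rpow_mul_posPart_le hq hqr (hK0.le.trans (haK j)) (sub_pos.1 hd)).trans ?_
              exact mul_le_mul_of_nonneg_right hcoef (by positivity)
          _ ≤ ENNReal.ofReal (C₁ * (2 ^ (2 * q + κ) * K ^ (-κ) * B ^ j)) *
                ENNReal.ofReal (M * η ^ j) := by
              rw [lintegral_const_mul' _ _ ENNReal.ofReal_ne_top]
              gcongr
          _ = ENNReal.ofReal (T ^ p) := by
              rw [← ENNReal.ofReal_mul (by positivity), hTp, hD, mul_pow]
              congr 1
              ring
      refine (hsob _ T (hK0.le.trans (haK _)) hT0 hE).trans (ENNReal.ofReal_le_ofReal ?_)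
      rw [hTr, ← mul_assoc, pow_succ', ← mul_assoc]
      gcongr
  refine ⟨2 * K, ?_⟩
  have hzero : ∫⁻ x, ENNReal.ofReal (max (u x - 2 * K) 0 ^ r) ∂μ = 0 := by
    refine le_antisymm ?_ zero_le
    have hlim : Tendsto (fun j : ℕ => ENNReal.ofReal (M * η ^ j)) atTop (𝓝 0) := by
      simpa using ENNReal.tendsto_ofReal
        ((tendsto_pow_atTop_nhds_zero_of_lt_one hη0.le hη1).const_mul M)
    refine ge_of_tendsto' hlim fun j => (lintegral_mono fun x => ?_).trans (hY j)
    refine ENNReal.ofReal_le_ofReal ?_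
    have := ha2K j
    gcongr
  rw [lintegral_eq_zero_iff' (((hu.sub_const _).max aemeasurable_const).pow_const r).ennreal_ofReal]
    at hzero
  filter_upwards [hzero] with x hx
  by_contra hcon
  push Not at hcon
  have h1 : 0 < max (u x - 2 * K) 0 ^ r :=
    Real.rpow_pos_of_pos (lt_max_of_lt_left (by linarith)) r
  have h2 : ENNReal.ofReal (max (u x - 2 * K) 0 ^ r) = 0 := hx
  exact absurd (ENNReal.ofReal_eq_zero.1 h2) h1.not_ge

end DeGiorgi

/-! ### Boundedness of nonnegative weak solutions -/

section Main

lemma exists_ae_abs_le_of_memLp_top {α : Type*} [MeasurableSpace α] {μ : Measure α} {f : α → ℝ}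
    (hf : MemLp f ⊤ μ) : ∃ C : ℝ, 0 < C ∧ ∀ᵐ x ∂μ, |f x| ≤ C := by
  have h := hf.2
  rw [eLpNorm_exponent_top] at h
  refine ⟨(eLpNormEssSup f μ).toReal + 1, by positivity, ?_⟩
  filter_upwards [ae_le_eLpNormEssSup (f := f) (μ := μ)] with x hx
  have h1 := ENNReal.toReal_mono h.ne hx
  rw [toReal_enorm, Real.norm_eq_abs] at h1
  linarith

variable {k : ℕ} {n : Fin k → ℕ} {G : StratifiedLieGroup n} {ν : HomogeneousQuasiNorm G}
  {s p δ q lam : ℝ} {Ω : Set (LayeredSpace n)} {f g u : LayeredSpace n → ℝ}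

/-- The right-hand side `lam f u^{-δ} + g u^q` is integrable against test functions once `u` has an
integrable power of exponent larger than `q`. -/
lemma IsNonnegWeakSolution.isWeakSolutionWith (hu : IsNonnegWeakSolution ν s p δ q lam Ω f g u)
    (hΩ : volume Ω < ⊤) (hδ0 : 0 < δ) (hq : 0 < q) (hlam : 0 < lam) {r : ℝ} (hqr : q < r)
    (hf : MemLp f ⊤ (volume.restrict Ω)) (hf_pos : ∀ᵐ x ∂volume.restrict Ω, 0 < f x)
    (hg : MemLp g ⊤ (volume.restrict Ω)) (hg_pos : ∀ᵐ x ∂volume.restrict Ω, 0 < g x)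
    (hur : ∫⁻ x in Ω, ENNReal.ofReal (|u x| ^ r) < ⊤) :
    IsWeakSolutionWith ν s p Ω u (fun x => lam * (f x * u x ^ (-δ)) + g x * u x ^ q) := by
  have hum : AEMeasurable u (volume.restrict Ω) := hu.mem.1.aemeasurable.restrict
  have hfm := hf.1.aemeasurable
  have hgm := hg.1.aemeasurable
  have hsing : ∀ ψ, IsTestFunction Ω ψ →
      IntegrableOn (fun x => f x * u x ^ (-δ) * ψ x) Ω := by
    intro ψ hψ
    refine ⟨((hfm.mul (hum.pow_const _)).mul
      hψ.1.continuous.measurable.aemeasurable).aestronglyMeasurable, ?_⟩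
    rw [hasFiniteIntegral_iff_enorm]
    refine (lintegral_mono_ae ?_).trans_lt (hu.singular_lt_top ψ hψ)
    filter_upwards [hu.nonneg, hf_pos] with x hx hfx
    -- where `u = 0` the real power `u ^ (-δ)` is `0`, below the value `∞` it has in `[0, ∞]`
    rcases hx.eq_or_lt with h | h
    · rw [← h, Real.zero_rpow (by linarith)]
      simp
    · rw [enorm_mul, enorm_mul, Real.enorm_eq_ofReal_abs, Real.enorm_eq_ofReal_abs,
        Real.enorm_eq_ofReal_abs, abs_of_pos hfx, abs_of_nonneg (by positivity),
        ENNReal.ofReal_rpow_of_pos h]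
  have hpow : ∀ ψ, IsTestFunction Ω ψ → IntegrableOn (fun x => g x * u x ^ q * ψ x) Ω := by
    intro ψ hψ
    obtain ⟨C, hC, hgC⟩ := exists_ae_abs_le_of_memLp_top hg
    obtain ⟨M, hM⟩ := hψ.2.1.exists_bound_of_continuous hψ.1.continuous
    have hfinite : IsFiniteMeasure (volume.restrict Ω) := ⟨by simpa using hΩ⟩
    have h1 : IntegrableOn (fun x => |u x| ^ r) Ω := by
      refine ⟨(hum.abs.pow_const r).aestronglyMeasurable, ?_⟩
      rwa [hasFiniteIntegral_iff_ofReal (ae_of_all _ fun x => by positivity)]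
    have h2 : IntegrableOn (fun x => C * M * (1 + |u x| ^ r)) Ω :=
      ((integrable_const 1).add h1).const_mul _
    refine h2.mono' ((hgm.mul (hum.pow_const _)).mul
      hψ.1.continuous.measurable.aemeasurable).aestronglyMeasurable ?_
    filter_upwards [hgC, hu.nonneg] with x hx hux
    have h3 : u x ^ q ≤ 1 + |u x| ^ r := by
      rw [abs_of_nonneg hux]
      rcases le_total (u x) 1 with h | h
      · have := Real.rpow_le_one hux h hq.le
        have h4 : 0 ≤ u x ^ r := by positivity
        linarith
      · have := Real.rpow_le_rpow_of_exponent_le h hqr.le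
        linarith
    have h4 : 0 ≤ u x ^ q := by positivity
    rw [norm_mul, norm_mul, Real.norm_of_nonneg h4, Real.norm_eq_abs (g x)]
    calc |g x| * u x ^ q * ‖ψ x‖ ≤ C * (1 + |u x| ^ r) * M := by
          gcongr
          exact hM x
      _ = _ := by ring
  refine ⟨?_, ((hfm.mul (hum.pow_const _)).const_mul lam).add (hgm.mul (hum.pow_const _)),
    fun ψ hψ => ?_, fun ψ hψ => ?_⟩
  · filter_upwards [hu.nonneg, hf_pos, hg_pos] with x hx hfx hgx
    positivity
  · refine (((hsing ψ hψ).const_mul lam).add (hpow ψ hψ)).congr (ae_of_all _ fun x => ?_)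
    simp only [Pi.add_apply]
    ring
  · have h1 := hu.weak_eq ψ hψ
    have h2 : ∫ x in Ω, (lam * (f x * u x ^ (-δ)) + g x * u x ^ q) * ψ x =
        lam * (∫ x in Ω, f x * u x ^ (-δ) * ψ x) + ∫ x in Ω, g x * u x ^ q * ψ x := by
      rw [← integral_const_mul, ← integral_add ((hsing ψ hψ).const_mul lam) (hpow ψ hψ)]
      refine integral_congr_ae (ae_of_all _ fun x => ?_)
      beta_reduce
      ring
    rw [h2]
    linarith

end Main

theorem lemma5p5 {k : ℕ} {n : Fin k → ℕ} (G : StratifiedLieGroup n) (ν : HomogeneousQuasiNorm G)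
    (Ω : Set (LayeredSpace n)) (hΩ_open : IsOpen Ω) (hΩ_conn : IsConnected Ω)
    (hΩ_bdd : Bornology.IsBounded Ω)
    (s p δ q lam : ℝ) (hs0 : 0 < s) (hs1 : s < 1) (hδ0 : 0 < δ) (hδ1 : δ < 1)
    (hp : 1 < p) (hsp : s * p < homDim n) (hpq : p < q + 1)
    (hq : q + 1 < (homDim n : ℝ) * p / ((homDim n : ℝ) - s * p)) (hlam : 0 < lam)
    (f g : LayeredSpace n → ℝ)
    (hf : MemLp f ⊤ (volume.restrict Ω)) (hf_pos : ∀ᵐ x ∂volume.restrict Ω, 0 < f x)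
    (hg : MemLp g ⊤ (volume.restrict Ω)) (hg_pos : ∀ᵐ x ∂volume.restrict Ω, 0 < g x)
    (u : LayeredSpace n → ℝ) (hu : IsNonnegWeakSolution ν s p δ q lam Ω f g u) :
    MemLp u ⊤ (volume.restrict Ω) := by
  have hq0 : 0 < q := by linarith
  have hp0 : 0 < p := by linarith
  have hΩ : volume Ω < ⊤ := hΩ_bdd.measure_lt_top
  obtain ⟨r, hqr, hr⟩ := exists_between hq
  have hr0 : 0 < r := by linarith
  have hum : AEStronglyMeasurable u volume := hu.mem.1
  obtain ⟨C₀, -, hsob⟩ :=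
    exists_lintegral_rpow_le_of_gagliardoEnergy_le ν hs0 hp hsp hΩ hr0 hr
  have hfin : ∫⁻ x in Ω, ENNReal.ofReal (|u x| ^ r) < ⊤ := by
    have h1 := hu.mem.gagliardoSeminorm_lt_top ν hs0 hs1 hp
    rw [gagliardoSeminorm_eq, ENNReal.rpow_lt_top_iff_of_pos (by positivity)] at h1
    refine (hsob u hum hu.mem.2.1 (((gagliardoEnergy ν s p u).toReal + 1) ^ (1 / p))
      (by positivity) ?_).trans_lt ENNReal.ofReal_lt_top
    rw [← Real.rpow_mul (by positivity), one_div_mul_cancel hp0.ne', Real.rpow_one]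
    rw [← ENNReal.ofReal_toReal h1.ne]
    exact ENNReal.ofReal_le_ofReal (by simp)
  have hW := hu.isWeakSolutionWith hΩ hδ0 hq0 hlam (by linarith : q < r) hf hf_pos hg hg_pos hfin
  obtain ⟨F, hF, hfF⟩ := exists_ae_abs_le_of_memLp_top hf
  obtain ⟨H, hH, hgH⟩ := exists_ae_abs_le_of_memLp_top hg
  have hbound : ∃ M : ℝ, ∀ᵐ x ∂volume.restrict Ω, u x ≤ M := by
    refine exists_ae_le_of_deGiorgi hum.aemeasurable.restrict hp hpq hqr
      (fun a => gagliardoEnergy ν s p fun x => max (u x - a) 0) (C₀ := C₀) (C₁ := lam * F + H)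
      (by positivity) (fun a T ha hT hE => ?_) (fun a ha => ?_) hfin
    · refine le_trans (le_of_eq ?_) (hsob (fun x => max (u x - a) 0)
        ((hum.aemeasurable.sub_const a).max aemeasurable_const).aestronglyMeasurable ?_ T hT hE)
      · refine lintegral_congr fun x => ?_
        rw [abs_of_nonneg (le_max_right _ _)]
      · filter_upwards [hu.mem.2.1] with x hx
        rw [hx, zero_sub, max_eq_right (by linarith)]
    · refine (hW.gagliardoEnergy_posPart_le hs0 hs1 hp hu.mem (by linarith)).trans
        (lintegral_mono_ae ?_)
      filter_upwards [hu.nonneg, hfF, hgH] with x hx hfx hgx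
      refine ENNReal.ofReal_le_ofReal ?_
      rw [max_eq_left hx, ← mul_assoc (lam * F + H)]
      rcases le_or_gt (u x) a with h | h
      · rw [max_eq_right (by linarith : u x - a ≤ 0)]
        simp
      have h1 : 1 ≤ u x := by linarith
      have h2 : u x ^ (-δ) ≤ u x ^ q := Real.rpow_le_rpow_of_exponent_le h1 (by linarith)
      refine mul_le_mul_of_nonneg_right ?_ (le_max_right _ _)
      calc lam * (f x * u x ^ (-δ)) + g x * u x ^ q
          ≤ lam * (F * u x ^ q) + H * u x ^ q := by
            gcongr
            · exact (le_abs_self _).trans hfx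
            · exact (le_abs_self _).trans hgx
        _ = (lam * F + H) * u x ^ q := by ring
  obtain ⟨M, hM⟩ := hbound
  refine memLp_top_of_bound hum.restrict M ?_
  filter_upwards [hM, hu.nonneg] with x hx hx0
  rwa [Real.norm_of_nonneg hx0]
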